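/- Let $1\le N_T\le N_R$, $N=N_R-N_T+1$, $K\ge 0$, $\Gamma_s>0$. Let $R_T$ be a Hermitian positive definite $N_T\times N_T$ matrix with unit diagonal. Consider the channel matrix $$H=\sqrt{\tfrac{K}{K+1}}\,H_{d,n}+\sqrt{\tfrac1{K+1}}\,H_{r,n}\in\mathbb C^{N_R\times N_T},$$ where $H_{d,n}$ is deterministic with $\|H_{d,n}\|_F^2=N_TN_R$ and all columns except the first equal to zero (Rician–Rayleigh fading), and $H_{r,n}$ is a zero-mean circularly-symmetric jointly Gaussian random matrix whose rows are mutually uncorrelated, each conjugate-transposed row having law $\mathcal{CN}(0,R_T)$. The zero-forcing SNR of stream 1 is $\gamma_1=\Gamma_s/[(H^{\mathcal H}H)^{-1}]_{1,1}$. Put $$\Gamma_1=\frac{\Gamma_s}{(K+1)[R_T^{-1}]_{1,1}},\qquad a=K N_R N_T [R_T^{-1}]_{1,1},\qquad A_n(a)=\frac{(N)_n}{(N_R)_n}\frac{a^n}{n!},$$ with $(x)_n$ the Pochhammer symbol, and let $\gamma(\kappa,x)=\int_0^x t^{\kappa-1}e^{-t}\,dt$ and $E_1(x)=\int_x^\infty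 t^{-1}e^{-t}\,dt$. Then all series below converge, all integrals below are finite, and the following hold. 1. (Density and outage probability) The law of $\gamma_1$ has on $[0,\infty)$ the (nonnegative) density $$p_{\gamma_1}(t)=\sum_{n=0}^\infty A_n(a)\sum_{m=0}^n\binom nm(-1)^m\frac{t^{N+n-m-1}e^{-t/\Gamma_1}}{(N+n-m-1)!\,\Gamma_1^{N+n-m}},$$ and for every $\gamma_{\mathrm{th}}\ge 0$ $$\Pr(\gamma_1\le\gamma_{\mathrm{th}})=\int_0^{\gamma_{\mathrm{th}}}p_{\gamma_1}(t)\,dt=\sum_{n=0}^\infty A_n(a)\sum_{m=0}^n\binom nm(-1)^m\frac{\gamma(N+n-m,\gamma_{\mathrm{th}}/\Gamma_1)}{(N+n-m-1)!}.$$ 2. (Ergodic capacity) $$\mathbb E\{\log_2(1+\gamma_1)\}=\int_0^\infty\frac{\ln(1+t)}{\ln 2}\,p_{\gamma_1}(t)\,dt=\frac1{\ln 2}\sum_{n=0}^\infty A_n(a)B_n,$$ $$B_n=\sum_{Q=N-1}^{n+N-1}\binom{n}{n+N-1-Q}(-1)^{n+N-1-Q}C_Q(\Gamma_1).$$ 3.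 For every integer $Q\ge 0$, $$\begin{aligned}C_Q(\Gamma_1)&:=\frac1{Q!}\frac1{\Gamma_1^{Q+1}}\int_0^\infty\ln(1+t)\,t^Qe^{-t/\Gamma_1}\,dt=\frac1{Q!}\int_0^\infty\ln(1+\Gamma_1y)\,y^Qe^{-y}\,dy\\&=e^{1/\Gamma_1}E_1(1/\Gamma_1)+\sum_{q_1=1}^{Q}\frac1{q_1!}\Big[\Big(-\frac1{\Gamma_1}\Big)^{q_1}e^{1/\Gamma_1}E_1(1/\Gamma_1)+\sum_{q_2=0}^{q_1-1}\Big(-\frac1{\Gamma_1}\Big)^{q_2}(q_1-q_2-1)!\Big].\end{aligned}$$ -/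

import Mathlib

open MeasureTheory ProbabilityTheory Matrix
open scoped Kronecker ComplexConjugate ComplexOrder

noncomputable section

/-- `X ∼ CN(m, S)` under `P`: the complex random vector `X` is Gaussian (as a real random vector),
has mean `m` and covariance `E[(X - m)(X - m)ᴴ] = S`, and is circularly symmetric about its mean,
which for Gaussian vectors says that the pseudo-covariance `E[(X - m)(X - m)ᵀ]` vanishes. -/
structure IsComplexGaussian {Ω ι : Type*} [MeasurableSpace Ω] [Fintype ι]
    (X : Ω → ι → ℂ) (m : ι → ℂ) (S : Matrix ι ι ℂ) (P : Measure Ω) : Prop where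
  hasGaussianLaw : HasGaussianLaw X P
  mean : ∀ i, ∫ ω, X ω i ∂P = m i
  covariance : ∀ i j, ∫ ω, (X ω i - m i) * conj (X ω j - m j) ∂P = S i j
  pseudoCovariance : ∀ i j, ∫ ω, (X ω i - m i) * (X ω j - m j) ∂P = 0

/-- The normalized random part of the fading: an `N_R × N_T` jointly Gaussian, circularly
symmetric, zero-mean matrix whose conjugate-transposed rows have law `CN(0, R_T)` and are mutually
uncorrelated (zero receive-correlation). Equivalently, the family of the conjugated entries,
indexed by (row, column), has law `CN(0, I ⊗ R_T)`. -/
def IsTransmitCorrelatedFading {Ω : Type*} [MeasurableSpace Ω] {NR NT : ℕ}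
    (Hrn : Ω → Matrix (Fin NR) (Fin NT) ℂ) (RT : Matrix (Fin NT) (Fin NT) ℂ)
    (P : Measure Ω) : Prop :=
  IsComplexGaussian (fun ω (p : Fin NR × Fin NT) => conj (Hrn ω p.1 p.2)) 0
    ((1 : Matrix (Fin NR) (Fin NR) ℂ) ⊗ₖ RT) P

/-- The channel matrix `H = √(K/(K+1)) H_{d,n} + √(1/(K+1)) H_{r,n}`. -/
def ricianChannel {Ω : Type*} {NR NT : ℕ} (K : ℝ) (Hdn : Matrix (Fin NR) (Fin NT) ℂ)
    (Hrn : Ω → Matrix (Fin NR) (Fin NT) ℂ) (ω : Ω) : Matrix (Fin NR) (Fin NT) ℂ :=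
  ((Real.sqrt (K / (K + 1)) : ℝ) : ℂ) • Hdn + ((Real.sqrt (1 / (K + 1)) : ℝ) : ℂ) • Hrn ω

/-- The zero-forcing SNR of stream 1 (column index `0`), `γ₁ = Γ_s / [(Hᴴ H)⁻¹]₁₁`. -/
def zfSNR {NR NT : ℕ} [NeZero NT] (Γs : ℝ) (H : Matrix (Fin NR) (Fin NT) ℂ) : ℝ :=
  Γs / ((Hᴴ * H)⁻¹ 0 0).re

/-- `Γ₁ = Γ_s / ((K + 1) [R_T⁻¹]₁₁)`, i.e. `Γ_s / [R_{T,K}⁻¹]₁₁` with `R_{T,K} = R_T / (K + 1)`. -/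
def scaleΓ₁ {NT : ℕ} [NeZero NT] (Γs K : ℝ) (RT : Matrix (Fin NT) (Fin NT) ℂ) : ℝ :=
  Γs / ((K + 1) * (RT⁻¹ 0 0).re)

/-- `a = K N_R N_T [R_T⁻¹]₁₁`. -/
def ricianParam {NT : ℕ} [NeZero NT] (NR : ℕ) (K : ℝ) (RT : Matrix (Fin NT) (Fin NT) ℂ) : ℝ :=
  K * NR * NT * (RT⁻¹ 0 0).re

/-- `A_n(σ) = (N)_n / (N_R)_n · σⁿ / n!`, with Pochhammer symbols. -/
def coeffA (N NR n : ℕ) (σ : ℝ) : ℝ :=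
  (ascPochhammer ℝ n).eval (N : ℝ) / (ascPochhammer ℝ n).eval (NR : ℝ) * (σ ^ n / n.factorial)

/-- The lower incomplete gamma function `γ(κ, x) = ∫₀ˣ t^{κ-1} e^{-t} dt`. -/
def lowerIncompleteGamma (κ x : ℝ) : ℝ :=
  ∫ t in (0 : ℝ)..x, t ^ (κ - 1) * Real.exp (-t)

/-- The exponential integral `E₁(x) = ∫ₓ^∞ t⁻¹ e^{-t} dt`, `x > 0`. -/
def expIntegralE₁ (x : ℝ) : ℝ :=
  ∫ t in Set.Ioi x, t⁻¹ * Real.exp (-t)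

/-- The density of the gamma distribution with integer shape `k ≥ 1` and scale `Γ`, at `t ≥ 0`. -/
def gammaDensity (k : ℕ) (Γ t : ℝ) : ℝ :=
  t ^ (k - 1) * Real.exp (-t / Γ) / ((k - 1).factorial * Γ ^ k)

/-- The `n`-th term of the series for the SNR density. -/
def densityTerm (N NR : ℕ) (a Γ₁ t : ℝ) (n : ℕ) : ℝ :=
  coeffA N NR n a *
    ∑ m ∈ Finset.range (n + 1), (n.choose m : ℝ) * (-1) ^ m * gammaDensity (N + n - m) Γ₁ t

/-- The series `p_{γ₁}(t)`, an infinite linear combination of gamma densities. -/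
def snrDensity (N NR : ℕ) (a Γ₁ t : ℝ) : ℝ :=
  ∑' n, densityTerm N NR a Γ₁ t n

/-- The `n`-th term of the series for the outage probability at threshold `γth`. -/
def outageTerm (N NR : ℕ) (a Γ₁ γth : ℝ) (n : ℕ) : ℝ :=
  coeffA N NR n a *
    ∑ m ∈ Finset.range (n + 1), (n.choose m : ℝ) * (-1) ^ m *
      (lowerIncompleteGamma ((N + n - m : ℕ) : ℝ) (γth / Γ₁) / ((N + n - m - 1).factorial : ℝ))

/-- `C_Q(Γ) = (1/Q!) (1/Γ^{Q+1}) ∫₀^∞ ln(1+t) t^Q e^{-t/Γ} dt`. -/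
def capC (Q : ℕ) (Γ : ℝ) : ℝ :=
  1 / (Q.factorial : ℝ) * (1 / Γ ^ (Q + 1)) *
    ∫ t in Set.Ioi (0 : ℝ), Real.log (1 + t) * t ^ Q * Real.exp (-t / Γ)

/-- `B_n = ∑_{Q=N-1}^{n+N-1} binom(n, n+N-1-Q) (-1)^{n+N-1-Q} C_Q(Γ)` (for `N ≥ 1`). -/
def capB (N n : ℕ) (Γ : ℝ) : ℝ :=
  ∑ Q ∈ Finset.Icc (N - 1) (n + N - 1),
    (n.choose (n + N - 1 - Q) : ℝ) * (-1) ^ (n + N - 1 - Q) * capC Q Γ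

end

/-! ### Gamma and noncentral gamma densities -/

/-! The proof is geometric. Let ρ = [R_T⁻¹]₁₁ and choose M with Mᴴ R_T M = 1 whose first row is (√ρ,
0, …, 0) (`exists_whitening`). After multiplication of H by √(2(K+1)) M, the columns become
independent standard Gaussian vectors in ℂ^{N_R}, regarded as a real space of dimension 2N_R
(`hasLaw_whitenedColumns`). Because of the shape of the first row of M, the specular part stays
confined to the first column, as a mean vector m with ‖m‖²/2 = a, and the (1,1) entry of the inverse
Gram matrix only changes by a scalar (`zfSNR_ricianChannel_eq`). Hence γ₁ = Γ₁ · d²/2, where d is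
the distance from the first whitened column to the span of the others (`residualSq_eq`).

Condition on the other columns z. Almost surely they are linearly independent, so the orthogonal
complement W of their span has real dimension 2N, and γ₁ is noncentral gamma with parameter b = ‖P_W
m‖²/2 (`map_normSq_starProjection_stdGaussian`, proved by comparing moment generating functions).
Expanding e^{-b} inside the Poisson mixture turns its density into a power series in b, whose
coefficients are the alternating sums of gamma densities (`hasSum_ncGammaDensity`).

It remains to average bⁿ over z. By homogeneity and unitary invariance, E bⁿ = κ (‖m‖²/2)ⁿ.
Replacing m by a Gaussian vector and integrating in both orders gives κ = (N)_n/(N_R)_n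
(`lintegral_residualSq_pow`). This produces A_n(a) and the density (`map_residualSq_stdGaussian`).

Outage and capacity are integrals of this density against an indicator and a logarithm. Since A_n(a)
≤ aⁿ/n!, termwise integration is dominated by an exponential series (`integral_mul_snrDensity`). The
closed form of C_Q comes from integration by parts and a one-step recurrence for ∫ y^q e^{-y}/(y+c)
dy (`capC_eq`). -/

lemma integral_pow_mul_exp_neg_mul (n : ℕ) {r : ℝ} (hr : 0 < r) :
    ∫ t in Set.Ioi (0 : ℝ), t ^ n * Real.exp (-(r * t)) = n.factorial / r ^ (n + 1) := by
  have h := Real.integral_rpow_mul_exp_neg_mul_Ioi (a := n + 1) (by positivity) hr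
  rw [Real.Gamma_nat_eq_factorial] at h
  simp only [add_sub_cancel_right, Real.rpow_natCast] at h
  rw [h]
  have : (1 / r) ^ ((n : ℝ) + 1) = (1 / r) ^ (n + 1) := by exact_mod_cast Real.rpow_natCast _ (n + 1)
  rw [this, one_div, inv_pow]
  ring

lemma integrableOn_pow_mul_exp_neg_mul (n : ℕ) {r : ℝ} (hr : 0 < r) :
    IntegrableOn (fun t => t ^ n * Real.exp (-(r * t))) (Set.Ioi 0) := by
  -- A non-integrable function has integral 0 by convention, whereas the value just computed is
  -- positive.
  by_contra h
  have h1 := integral_undef h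
  rw [integral_pow_mul_exp_neg_mul n hr] at h1
  have : 0 < (n.factorial : ℝ) / r ^ (n + 1) := by positivity
  linarith

lemma gammaDensity_nonneg {k : ℕ} {Γ t : ℝ} (hΓ : 0 < Γ) (ht : 0 ≤ t) :
    0 ≤ gammaDensity k Γ t := by
  unfold gammaDensity; positivity

/-- Up to the factor 1/Γ the density is a Poisson weight, since x^k/k! ≤ e^x. Uniformity in the
shape is what makes every later series converge. -/
lemma gammaDensity_succ_le (k : ℕ) {Γ t : ℝ} (hΓ : 0 < Γ) (ht : 0 ≤ t) :
    gammaDensity (k + 1) Γ t ≤ 1 / Γ := by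
  have h := Real.pow_div_factorial_le_exp (t / Γ) (by positivity) k
  unfold gammaDensity
  rw [Nat.add_sub_cancel, neg_div, Real.exp_neg]
  calc t ^ k * (Real.exp (t / Γ))⁻¹ / (k.factorial * Γ ^ (k + 1))
      = (t / Γ) ^ k / k.factorial * (Real.exp (t / Γ))⁻¹ / Γ := by
        rw [div_pow, pow_succ]; field_simp
    _ ≤ Real.exp (t / Γ) * (Real.exp (t / Γ))⁻¹ / Γ := by gcongr
    _ = 1 / Γ := by rw [mul_inv_cancel₀ (Real.exp_pos _).ne']

@[fun_prop]
lemma continuous_gammaDensity (k : ℕ) (Γ : ℝ) : Continuous (gammaDensity k Γ) := by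
  unfold gammaDensity; fun_prop

lemma exp_mul_gammaDensity (k : ℕ) {Γ : ℝ} (hΓ : 0 < Γ) (s t : ℝ) :
    Real.exp (s * t) * gammaDensity (k + 1) Γ t =
      1 / (k.factorial * Γ ^ (k + 1)) * (t ^ k * Real.exp (-((1 / Γ - s) * t))) := by
  unfold gammaDensity
  have : -((1 / Γ - s) * t) = s * t + -t / Γ := by field_simp; ring
  rw [this, Real.exp_add, Nat.add_sub_cancel]
  ring

lemma integrableOn_exp_mul_gammaDensity (k : ℕ) {Γ s : ℝ} (hΓ : 0 < Γ) (hs : Γ * s < 1) :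
    IntegrableOn (fun t => Real.exp (s * t) * gammaDensity (k + 1) Γ t) (Set.Ioi 0) := by
  have hr : 0 < 1 / Γ - s := by
    rw [sub_pos, lt_div_iff₀ hΓ]; linarith
  simp_rw [exp_mul_gammaDensity k hΓ]
  exact (integrableOn_pow_mul_exp_neg_mul k hr).const_mul _

lemma integral_exp_mul_gammaDensity (k : ℕ) {Γ s : ℝ} (hΓ : 0 < Γ) (hs : Γ * s < 1) :
    ∫ t in Set.Ioi 0, Real.exp (s * t) * gammaDensity (k + 1) Γ t =
      ((1 - Γ * s) ^ (k + 1))⁻¹ := by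
  have hr : 0 < 1 / Γ - s := by
    rw [sub_pos, lt_div_iff₀ hΓ]; linarith
  simp_rw [exp_mul_gammaDensity k hΓ]
  rw [integral_const_mul, integral_pow_mul_exp_neg_mul k hr]
  have h1 : 1 - Γ * s = Γ * (1 / Γ - s) := by field_simp
  rw [h1, mul_pow]
  field_simp

lemma lintegral_exp_mul_gammaDensity (k : ℕ) {Γ s : ℝ} (hΓ : 0 < Γ) (hs : Γ * s < 1) :
    ∫⁻ t in Set.Ici 0, ENNReal.ofReal (Real.exp (s * t) * gammaDensity (k + 1) Γ t) =
      ENNReal.ofReal ((1 - Γ * s) ^ (k + 1))⁻¹ := by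
  rw [← integral_exp_mul_gammaDensity k hΓ hs, Measure.restrict_congr_set Ioi_ae_eq_Ici.symm,
    ofReal_integral_eq_lintegral_ofReal (integrableOn_exp_mul_gammaDensity k hΓ hs)]
  filter_upwards [ae_restrict_mem measurableSet_Ioi] with t ht
  exact mul_nonneg (Real.exp_pos _).le (gammaDensity_nonneg hΓ (le_of_lt ht))

/-- The density of the noncentral gamma distribution, i.e. the Poisson mixture, with parameter `b`,
of the gamma distributions with shapes `N + j` and scale `Γ`. -/
noncomputable def ncGammaDensity (N : ℕ) (Γ b t : ℝ) : ℝ :=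
  ∑' j : ℕ, Real.exp (-b) * (b ^ j / j.factorial) * gammaDensity (N + j) Γ t

lemma summable_ncGammaDensity {N : ℕ} (hN : 1 ≤ N) {Γ t : ℝ} (hΓ : 0 < Γ) (b : ℝ)
    (ht : 0 ≤ t) :
    Summable fun j : ℕ => Real.exp (-b) * (b ^ j / j.factorial) * gammaDensity (N + j) Γ t := by
  obtain ⟨M, rfl⟩ : ∃ M, N = M + 1 := ⟨N - 1, by omega⟩
  refine Summable.of_norm_bounded (g := fun j => Real.exp (-b) * (|b| ^ j / j.factorial) * (1 / Γ))
    (((Real.summable_pow_div_factorial _).mul_left _).mul_right _) fun j => ?_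
  rw [Real.norm_eq_abs, abs_mul, abs_mul, abs_div, abs_pow, Nat.abs_cast, Real.abs_exp,
    abs_of_nonneg (gammaDensity_nonneg hΓ ht), show M + 1 + j = M + j + 1 by ring]
  gcongr
  exact gammaDensity_succ_le _ hΓ ht

lemma ncGammaDensity_nonneg (N : ℕ) {Γ b t : ℝ} (hΓ : 0 < Γ) (hb : 0 ≤ b) (ht : 0 ≤ t) :
    0 ≤ ncGammaDensity N Γ b t :=
  tsum_nonneg fun j => mul_nonneg (by positivity) (gammaDensity_nonneg hΓ ht)

lemma ncGammaDensity_zero (N : ℕ) (Γ t : ℝ) : ncGammaDensity N Γ 0 t = gammaDensity N Γ t := by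
  unfold ncGammaDensity
  rw [tsum_eq_single 0 fun j hj => by simp [hj]]
  simp

lemma ofReal_ncGammaDensity {N : ℕ} (hN : 1 ≤ N) {Γ b t : ℝ} (hΓ : 0 < Γ) (hb : 0 ≤ b)
    (ht : 0 ≤ t) : ENNReal.ofReal (ncGammaDensity N Γ b t) =
      ∑' j : ℕ, ENNReal.ofReal (Real.exp (-b) * (b ^ j / j.factorial) *
        gammaDensity (N + j) Γ t) :=
  ENNReal.ofReal_tsum_of_nonneg
    (fun j => mul_nonneg (by positivity) (gammaDensity_nonneg hΓ ht))
    (summable_ncGammaDensity hN hΓ b ht)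

@[fun_prop]
lemma measurable_ncGammaDensity (N : ℕ) (Γ : ℝ) :
    Measurable fun p : ℝ × ℝ => ncGammaDensity N Γ p.1 p.2 := by
  unfold ncGammaDensity
  refine Measurable.tsum fun j => ?_
  have := (continuous_gammaDensity (N + j) Γ).measurable
  fun_prop

/-- Each gamma component contributes a power of 1/(1 - Γs), so the Poisson mixture sums to an
exponential with exponent b/(1 - Γs) - b = bΓs/(1 - Γs). -/
lemma lintegral_exp_mul_ncGammaDensity {N : ℕ} (hN : 1 ≤ N) {Γ b s : ℝ} (hΓ : 0 < Γ)
    (hb : 0 ≤ b) (hs : Γ * s < 1) :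
    ∫⁻ t in Set.Ici 0, ENNReal.ofReal (Real.exp (s * t)) *
      ENNReal.ofReal (ncGammaDensity N Γ b t) =
      ENNReal.ofReal (((1 - Γ * s) ^ N)⁻¹ * Real.exp (b * (Γ * s / (1 - Γ * s)))) := by
  obtain ⟨M, rfl⟩ : ∃ M, N = M + 1 := ⟨N - 1, by omega⟩
  have h1 : 0 < 1 - Γ * s := by linarith
  have key : ∀ t ∈ Set.Ici (0 : ℝ), ENNReal.ofReal (Real.exp (s * t)) *
      ENNReal.ofReal (ncGammaDensity (M + 1) Γ b t) = ∑' j : ℕ,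
        ENNReal.ofReal (Real.exp (-b) * (b ^ j / j.factorial)) *
        ENNReal.ofReal (Real.exp (s * t) * gammaDensity (M + j + 1) Γ t) := by
    intro t ht
    rw [ofReal_ncGammaDensity hN hΓ hb ht, ← ENNReal.tsum_mul_left]
    refine tsum_congr fun j => ?_
    rw [← ENNReal.ofReal_mul (by positivity), ← ENNReal.ofReal_mul (by positivity),
      show M + 1 + j = M + j + 1 by ring]
    congr 1; ring
  rw [setLIntegral_congr_fun measurableSet_Ici key, lintegral_tsum]
  · simp_rw [lintegral_const_mul' _ _ ENNReal.ofReal_ne_top, lintegral_exp_mul_gammaDensity _ hΓ hs]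
    have : ∀ j : ℕ, ENNReal.ofReal (Real.exp (-b) * (b ^ j / j.factorial)) *
        ENNReal.ofReal ((1 - Γ * s) ^ (M + j + 1))⁻¹ =
        ENNReal.ofReal (((1 - Γ * s) ^ (M + 1))⁻¹ * Real.exp (-b) *
          ((b / (1 - Γ * s)) ^ j / j.factorial)) := by
      intro j
      rw [← ENNReal.ofReal_mul (by positivity)]
      congr 1
      rw [show M + j + 1 = M + 1 + j by ring, pow_add, div_pow]
      field_simp
    simp_rw [this]
    rw [← ENNReal.ofReal_tsum_of_nonneg (fun j => by positivity)
      ((Real.summable_pow_div_factorial _).mul_left _), tsum_mul_left]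
    congr 1
    have he := (congrFun Real.exp_eq_exp_ℝ (b / (1 - Γ * s))).trans
      (congrFun (NormedSpace.exp_eq_tsum_div (𝔸 := ℝ)) (b / (1 - Γ * s)))
    rw [← he, mul_assoc, ← Real.exp_add]
    congr 2
    field_simp
    ring
  · intro j
    have := (continuous_gammaDensity (M + j + 1) Γ).measurable
    fun_prop

/-- Two measures on the line with the same finite moment generating function on a half-line
`s < c`, where `0 < c`, are equal. -/
theorem MeasureTheory.Measure.ext_of_lintegral_exp_mul {μ ν : Measure ℝ} {c : ℝ} (hc : 0 < c)
    (hfin : ∀ s < c, ∫⁻ x, ENNReal.ofReal (Real.exp (s * x)) ∂μ ≠ ⊤)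
    (h : ∀ s < c, ∫⁻ x, ENNReal.ofReal (Real.exp (s * x)) ∂μ =
      ∫⁻ x, ENNReal.ofReal (Real.exp (s * x)) ∂ν) : μ = ν := by
  have fin : ∀ m : Measure ℝ, (∀ s < c, ∫⁻ x, ENNReal.ofReal (Real.exp (s * x)) ∂m ≠ ⊤) →
      IsFiniteMeasure m := fun m hm => ⟨by simpa using (hm 0 hc).lt_top⟩
  have hfin' : ∀ s < c, ∫⁻ x, ENNReal.ofReal (Real.exp (s * x)) ∂ν ≠ ⊤ := fun s hs =>
    h s hs ▸ hfin s hs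
  have := fin μ hfin
  have := fin ν hfin'
  have hint : ∀ m : Measure ℝ, (∀ s < c, ∫⁻ x, ENNReal.ofReal (Real.exp (s * x)) ∂m ≠ ⊤) →
      {z : ℂ | z.re < c} ⊆ {z | z.re ∈ interior (integrableExpSet id m)} := by
    intro m hm z hz
    refine interior_maximal (s := integrableExpSet id m) (t := Set.Iio c) (fun s hs => ?_)
      isOpen_Iio hz
    refine ⟨by fun_prop, ?_⟩
    rw [hasFiniteIntegral_iff_ofReal (Filter.Eventually.of_forall fun x => (Real.exp_pos _).le)]
    exact (hm s hs).lt_top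
  have hmgf : ∀ s < c, mgf id μ s = mgf id ν s := by
    intro s hs
    simp only [mgf, id]
    rw [integral_eq_lintegral_of_nonneg_ae (Filter.Eventually.of_forall fun x => (Real.exp_pos _).le)
      (by fun_prop), integral_eq_lintegral_of_nonneg_ae
      (Filter.Eventually.of_forall fun x => (Real.exp_pos _).le) (by fun_prop), h s hs]
  -- Both transforms are analytic on this half-plane and agree on real points accumulating at 0. The
  -- identity theorem carries the equality to the imaginary axis, where they are the characteristic
  -- functions.
  have heq : Set.EqOn (complexMGF id μ) (complexMGF id ν) {z : ℂ | z.re < c} := by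
    refine AnalyticOnNhd.eqOn_of_preconnected_of_frequently_eq
      (analyticOnNhd_complexMGF.mono (hint μ hfin)) (analyticOnNhd_complexMGF.mono (hint ν hfin'))
      (convex_halfSpace_re_lt c).isPreconnected (z₀ := ((0 : ℝ) : ℂ)) (by simpa using hc) ?_
    have h_real : ∃ᶠ (x : ℝ) in nhdsWithin 0 {0}ᶜ, complexMGF id μ x = complexMGF id ν x := by
      refine Filter.Eventually.frequently ?_
      filter_upwards [nhdsWithin_le_nhds (Iio_mem_nhds hc)] with y hy
      rw [complexMGF_ofReal, complexMGF_ofReal, hmgf y hy]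
    rw [Filter.frequently_iff_seq_forall] at h_real ⊢
    obtain ⟨xs, hx_tendsto, hx_eq⟩ := h_real
    refine ⟨fun n ↦ xs n, ?_, fun n ↦ ?_⟩
    · rw [tendsto_nhdsWithin_iff] at hx_tendsto ⊢
      constructor
      · exact (Complex.continuous_ofReal.tendsto 0).comp hx_tendsto.1
      · simpa using hx_tendsto.2
    · simp [hx_eq]
  refine Measure.ext_of_charFun (funext fun t => ?_)
  rw [← complexMGF_id_mul_I, ← complexMGF_id_mul_I]
  exact heq (by simpa using hc)

/-! ### Squared norms of Gaussian vectors -/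

lemma integral_exp_sq_gaussianReal (m : ℝ) {σ : ℝ} (hσ : σ < 1) :
    ∫ x, Real.exp (σ * ((m + x) ^ 2 / 2)) ∂(gaussianReal 0 1) =
      (√(1 - σ))⁻¹ * Real.exp (m ^ 2 / 2 * (σ / (1 - σ))) := by
  have h1 : 0 < 1 - σ := by linarith
  -- Completing the square: the exponentially tilted Gaussian is again Gaussian, with variance 1/(1
  -- - σ) and mean mσ/(1 - σ).
  set v : NNReal := ⟨(1 - σ)⁻¹, by positivity⟩ with hv
  have hv0 : v ≠ 0 := by
    rw [← NNReal.coe_ne_zero]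
    exact (inv_pos.mpr h1).ne'
  have hvv : (v : ℝ) = (1 - σ)⁻¹ := rfl
  rw [integral_gaussianReal_eq_integral_smul one_ne_zero]
  have key : ∀ x : ℝ, gaussianPDFReal 0 1 x • Real.exp (σ * ((m + x) ^ 2 / 2)) =
      (√(1 - σ))⁻¹ * Real.exp (m ^ 2 / 2 * (σ / (1 - σ))) *
        gaussianPDFReal (m * σ / (1 - σ)) v x := by
    intro x
    have e1 : -(x - 0) ^ 2 / (2 * ((1 : NNReal) : ℝ)) + σ * ((m + x) ^ 2 / 2) =
        m ^ 2 / 2 * (σ / (1 - σ)) + -(x - m * σ / (1 - σ)) ^ 2 / (2 * (1 - σ)⁻¹) := by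
      rw [NNReal.coe_one]; field_simp; ring
    have e2 : (√(2 * Real.pi * ((1 : NNReal) : ℝ)))⁻¹ =
        (√(1 - σ))⁻¹ * (√(2 * Real.pi * (1 - σ)⁻¹))⁻¹ := by
      rw [← mul_inv, ← Real.sqrt_mul h1.le, NNReal.coe_one]
      congr 2; field_simp
    simp only [gaussianPDFReal, smul_eq_mul, hvv]
    rw [mul_assoc, ← Real.exp_add, e1, e2, Real.exp_add]
    ring
  simp_rw [key]
  rw [integral_const_mul, integral_gaussianPDFReal_eq_one _ hv0, mul_one]

section

variable {F : Type*} [NormedAddCommGroup F] [InnerProductSpace ℝ F] [FiniteDimensional ℝ F]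
  [MeasurableSpace F] [BorelSpace F]

/-- In an orthonormal basis the integrand is a product over independent coordinates. The 2N factors
(1 - σ)^{-1/2} combine to an integer power, which is why even dimension is used. -/
lemma lintegral_exp_normSq_stdGaussian {N : ℕ} (hF : Module.finrank ℝ F = 2 * N) (m : F) {σ : ℝ}
    (hσ : σ < 1) :
    ∫⁻ g, ENNReal.ofReal (Real.exp (σ * (‖m + g‖ ^ 2 / 2))) ∂(stdGaussian F) =
      ENNReal.ofReal (((1 - σ) ^ N)⁻¹ * Real.exp (‖m‖ ^ 2 / 2 * (σ / (1 - σ)))) := by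
  have h1 : 0 < 1 - σ := by linarith
  set b := stdOrthonormalBasis ℝ F with hb
  rw [stdGaussian_eq_map_pi_orthonormalBasis b, lintegral_map (by fun_prop) (by fun_prop)]
  have hexp : ∀ x : Fin (Module.finrank ℝ F) → ℝ,
      Real.exp (σ * (‖m + ∑ i, x i • b i‖ ^ 2 / 2)) =
        ∏ i, Real.exp (σ * ((inner ℝ (b i) m + x i) ^ 2 / 2)) := by
    intro x
    rw [← Real.exp_sum, ← Finset.mul_sum, ← Finset.sum_div, ← b.sum_sq_inner_right]
    congr 3
    refine Finset.sum_congr rfl fun i _ => ?_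
    rw [inner_add_right, b.orthonormal.inner_right_fintype]
  simp_rw [hexp]
  have hval : ∫ x : Fin (Module.finrank ℝ F) → ℝ,
      ∏ i, Real.exp (σ * ((inner ℝ (b i) m + x i) ^ 2 / 2)) ∂(Measure.pi fun _ => gaussianReal 0 1)
      = ((1 - σ) ^ N)⁻¹ * Real.exp (‖m‖ ^ 2 / 2 * (σ / (1 - σ))) := by
    rw [integral_fintype_prod_eq_prod
      (fun i (y : ℝ) => Real.exp (σ * ((inner ℝ (b i) m + y) ^ 2 / 2)))]
    simp_rw [integral_exp_sq_gaussianReal _ hσ]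
    rw [Finset.prod_mul_distrib, ← Real.exp_sum, ← Finset.sum_mul, ← Finset.sum_div,
      b.sum_sq_inner_right, Finset.prod_const, Finset.card_univ, Fintype.card_fin, hF, inv_pow,
      pow_mul, Real.sq_sqrt h1.le]
  rw [← hval, ofReal_integral_eq_lintegral_ofReal]
  · by_contra hint
    rw [integral_undef hint] at hval
    have : 0 < ((1 - σ) ^ N)⁻¹ * Real.exp (‖m‖ ^ 2 / 2 * (σ / (1 - σ))) := by positivity
    linarith
  · exact Filter.Eventually.of_forall fun x => Finset.prod_nonneg fun i _ => (Real.exp_pos _).le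

/-- Half the squared norm of a Gaussian vector with identity covariance on a real space of even
dimension has a noncentral gamma law. -/
theorem map_normSq_stdGaussian {N : ℕ} (hN : 1 ≤ N) (hF : Module.finrank ℝ F = 2 * N) (m : F)
    {Γ : ℝ} (hΓ : 0 < Γ) :
    (stdGaussian F).map (fun g => Γ * (‖m + g‖ ^ 2 / 2)) =
      (volume.restrict (Set.Ici 0)).withDensity
        (fun t => ENNReal.ofReal (ncGammaDensity N Γ (‖m‖ ^ 2 / 2) t)) := by
  have hL : ∀ s < 1 / Γ, ∫⁻ x, ENNReal.ofReal (Real.exp (s * x))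
      ∂((stdGaussian F).map (fun g => Γ * (‖m + g‖ ^ 2 / 2))) =
      ENNReal.ofReal (((1 - Γ * s) ^ N)⁻¹ *
        Real.exp (‖m‖ ^ 2 / 2 * (Γ * s / (1 - Γ * s)))) := by
    intro s hs
    rw [lintegral_map (by fun_prop) (by fun_prop), ← lintegral_exp_normSq_stdGaussian hF m
      (by rw [lt_div_iff₀ hΓ] at hs; linarith)]
    refine lintegral_congr fun g => ?_
    congr 2; ring
  refine Measure.ext_of_lintegral_exp_mul (c := 1 / Γ) (by positivity) (fun s hs => ?_)
    fun s hs => ?_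
  · rw [hL s hs]; exact ENNReal.ofReal_ne_top
  · have hm : Measurable fun t => ENNReal.ofReal (ncGammaDensity N Γ (‖m‖ ^ 2 / 2) t) :=
      ((measurable_ncGammaDensity N Γ).comp (measurable_const.prodMk measurable_id)).ennreal_ofReal
    rw [hL s hs, lintegral_withDensity_eq_lintegral_mul _ hm (by fun_prop),
      ← lintegral_exp_mul_ncGammaDensity hN hΓ (by positivity)
        (by rw [lt_div_iff₀ hΓ] at hs; linarith)]
    refine lintegral_congr fun t => ?_
    simp only [Pi.mul_apply]
    rw [mul_comm]

/-- A proper affine subspace, given by a non-constant linear equation, is Gaussian null. -/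
lemma stdGaussian_inner_eq_null {u : F} (hu : u ≠ 0) (c : ℝ) :
    stdGaussian F {g | inner ℝ u g = c} = 0 := by
  -- The image under ⟨u, ·⟩ is a real Gaussian of variance ‖u‖² > 0, hence has no atoms.
  have h1 : IsGaussian ((stdGaussian F).map (innerSL ℝ u)) := inferInstance
  have h2 := IsGaussian.eq_gaussianReal ((stdGaussian F).map (innerSL ℝ u)) h1
  have hv : Var[id; (stdGaussian F).map (innerSL ℝ u)] = ‖u‖ ^ 2 := by
    rw [variance_map (by fun_prop) (by fun_prop)]
    simpa using variance_dual_stdGaussian (innerSL ℝ u)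
  have hpos : (0 : ℝ) < ‖u‖ ^ 2 := by positivity
  rw [hv] at h2
  have hne : Real.toNNReal (‖u‖ ^ 2) ≠ 0 := by
    simpa using hu
  have : NullSingletonClass (gaussianReal (((stdGaussian F).map (innerSL ℝ u))[id]) (‖u‖ ^ 2).toNNReal) :=
    nullSingletonClass_gaussianReal hne
  have h3 := this.measure_singleton c
  rw [← h2, Measure.map_apply (by fun_prop) (measurableSet_singleton c)] at h3
  exact h3

/-- The orthogonal projection of a standard Gaussian vector on a subspace is standard Gaussian. -/
lemma stdGaussian_map_orthogonalProjectionOnto (W : Submodule ℝ F) :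
    (stdGaussian F).map W.orthogonalProjectionOnto = stdGaussian W := by
  refine Measure.ext_of_charFun (funext fun t => ?_)
  rw [charFun_stdGaussian, charFun_apply, integral_map (by fun_prop) (by fun_prop)]
  have : ∀ g : F, inner ℝ (W.orthogonalProjectionOnto g) t = inner ℝ g (t : F) := by simp
  simp_rw [this]
  rw [← charFun_apply, charFun_stdGaussian]
  simp

theorem map_normSq_starProjection_stdGaussian {N : ℕ} (hN : 1 ≤ N) {W : Submodule ℝ F}
    (hW : Module.finrank ℝ W = 2 * N) (m : F) {Γ : ℝ} (hΓ : 0 < Γ) :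
    (stdGaussian F).map (fun g => Γ * (‖W.starProjection (m + g)‖ ^ 2 / 2)) =
      (volume.restrict (Set.Ici 0)).withDensity
        (fun t => ENNReal.ofReal (ncGammaDensity N Γ (‖W.starProjection m‖ ^ 2 / 2) t)) := by
  have h := map_normSq_stdGaussian hN hW (W.orthogonalProjectionOnto m) hΓ
  rw [← stdGaussian_map_orthogonalProjectionOnto, Measure.map_map (by fun_prop) (by fun_prop)] at h
  have hn : ∀ x, ‖W.starProjection x‖ = ‖W.orthogonalProjectionOnto x‖ := fun x => rfl
  simp_rw [hn, map_add]
  exact h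

end

/-! ### The squared distance of a column to the span of the other columns -/

/-- The matrix with given columns. -/
def columnsMatrix {n r : ℕ} (c : Fin n → EuclideanSpace ℂ (Fin r)) : Matrix (Fin r) (Fin n) ℂ :=
  Matrix.of fun i j => c j i

lemma conjTranspose_columnsMatrix_mul_apply {n r : ℕ} (c : Fin n → EuclideanSpace ℂ (Fin r))
    (i j : Fin n) :
    ((columnsMatrix c)ᴴ * columnsMatrix c) i j = inner ℂ (c i) (c j) := by
  simp [columnsMatrix, Matrix.mul_apply, PiLp.inner_apply, mul_comm]

/-- The reciprocal of the first diagonal entry of the inverse Gram matrix of `y, z₁, …, z_k`. -/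
noncomputable def residualSq {k r : ℕ} (y : EuclideanSpace ℂ (Fin r))
    (z : Fin k → EuclideanSpace ℂ (Fin r)) : ℝ :=
  1 / (((columnsMatrix (Fin.cons y z : Fin (k + 1) → EuclideanSpace ℂ (Fin r)))ᴴ *
    columnsMatrix (Fin.cons y z : Fin (k + 1) → EuclideanSpace ℂ (Fin r)))⁻¹ 0 0).re

lemma residualSq_isometry {k r : ℕ} (U : EuclideanSpace ℂ (Fin r) ≃ₗᵢ[ℂ] EuclideanSpace ℂ (Fin r))
    (y : EuclideanSpace ℂ (Fin r)) (z : Fin k → EuclideanSpace ℂ (Fin r)) :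
    residualSq (U y) (fun j => U (z j)) = residualSq y z := by
  unfold residualSq
  have : (Fin.cons (U y) (fun j => U (z j)) : Fin (k + 1) → EuclideanSpace ℂ (Fin r)) =
      fun j => U ((Fin.cons y z : Fin (k + 1) → EuclideanSpace ℂ (Fin r)) j) := by
    ext1 j
    refine Fin.cases ?_ (fun j => ?_) j <;> simp
  have hG : (columnsMatrix fun j => U ((Fin.cons y z : Fin (k + 1) → _) j))ᴴ *
      (columnsMatrix fun j => U ((Fin.cons y z : Fin (k + 1) → _) j)) =
      (columnsMatrix (Fin.cons y z : Fin (k + 1) → _))ᴴ *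
      columnsMatrix (Fin.cons y z : Fin (k + 1) → _) := by
    ext i j
    rw [conjTranspose_columnsMatrix_mul_apply, conjTranspose_columnsMatrix_mul_apply,
      U.inner_map_map]
  rw [this, hG]

/-- Inversion is not continuous at singular matrices under the convention that their inverse is 0,
but det⁻¹ times the adjugate is measurable everywhere. -/
lemma Measurable.matrix_inv_apply {α : Type*} [MeasurableSpace α] {n : ℕ}
    {f : α → Matrix (Fin n) (Fin n) ℂ} (hf : ∀ i j, Measurable fun a => f a i j) (i j : Fin n) :
    Measurable fun a => (f a)⁻¹ i j := by
  have h : ∀ A : Matrix (Fin n) (Fin n) ℂ, A⁻¹ i j = (A.det)⁻¹ * A.adjugate i j := fun A => by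
    rw [Matrix.inv_def, Ring.inverse_eq_inv', Matrix.smul_apply, smul_eq_mul]
  simp_rw [h]
  have h0 : Measurable fun (a : α) (i j : Fin n) => f a i j :=
    measurable_pi_iff.mpr fun i => measurable_pi_iff.mpr fun j => hf i j
  have h1 : Continuous fun A : Fin n → Fin n → ℂ => (Matrix.of A).det :=
    Continuous.matrix_det (A := fun A : Fin n → Fin n → ℂ => Matrix.of A) continuous_id
  have h2 : Continuous fun A : Fin n → Fin n → ℂ => (Matrix.of A).adjugate i j :=
    (Continuous.matrix_adjugate (A := fun A : Fin n → Fin n → ℂ => Matrix.of A)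
      continuous_id).matrix_elem i j
  exact (h1.measurable.comp h0).inv.mul (h2.measurable.comp h0)

@[fun_prop]
lemma measurable_residualSq {k r : ℕ} :
    Measurable fun p : EuclideanSpace ℂ (Fin r) × (Fin k → EuclideanSpace ℂ (Fin r)) =>
      residualSq p.1 p.2 := by
  unfold residualSq
  refine measurable_const.div (Complex.measurable_re.comp
    (Measurable.matrix_inv_apply (fun i j => ?_) 0 0))
  simp_rw [conjTranspose_columnsMatrix_mul_apply]
  have hc : ∀ i : Fin (k + 1), Measurable
      fun p : EuclideanSpace ℂ (Fin r) × (Fin k → EuclideanSpace ℂ (Fin r)) =>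
        (Fin.cons p.1 p.2 : Fin (k + 1) → EuclideanSpace ℂ (Fin r)) i := by
    intro i
    refine Fin.cases ?_ (fun i => ?_) i
    · simpa using measurable_fst
    · simpa [Function.comp_def] using (measurable_pi_apply i).comp measurable_snd
  exact (hc i).inner (hc j)

lemma real_inner_eq_re_complex_inner {r : ℕ} (x y : EuclideanSpace ℂ (Fin r)) :
    inner ℝ x y = (inner ℂ x y).re := by
  simp [PiLp.inner_apply, Complex.inner]

/-- The orthogonal complement of the complex span of a family, as a real subspace. -/
noncomputable def orthSpan {k r : ℕ} (z : Fin k → EuclideanSpace ℂ (Fin r)) :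
    Submodule ℝ (EuclideanSpace ℂ (Fin r)) :=
  (Submodule.span ℂ (Set.range z))ᗮ.restrictScalars ℝ

lemma finrank_orthSpan {k r : ℕ} {z : Fin k → EuclideanSpace ℂ (Fin r)}
    (hz : LinearIndependent ℂ z) : Module.finrank ℝ (orthSpan z) = 2 * (r - k) := by
  have h1 := Submodule.finrank_add_finrank_orthogonal (Submodule.span ℂ (Set.range z))
  rw [finrank_span_eq_card hz, Fintype.card_fin, finrank_euclideanSpace, Fintype.card_fin] at h1
  have h2 : Module.finrank ℝ (orthSpan z) =
      Module.finrank ℝ ℂ * Module.finrank ℂ ↥(Submodule.span ℂ (Set.range z))ᗮ :=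
    (Module.finrank_mul_finrank ℝ ℂ ↥(Submodule.span ℂ (Set.range z))ᗮ).symm
  rw [h2, Complex.finrank_real_complex]
  omega

/-- Let q be the component of y orthogonal to the z's and C the matrix of all columns. Writing q =
Cx with x₀ = 1, orthogonality gives CᴴCx = Cᴴq = ‖q‖² e₀. Inverting CᴴC and reading coordinate 0
yields 1 = [(CᴴC)⁻¹]₀₀ ‖q‖². -/
lemma residualSq_eq {k r : ℕ} {z : Fin k → EuclideanSpace ℂ (Fin r)}
    (hz : LinearIndependent ℂ z) (y : EuclideanSpace ℂ (Fin r)) :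
    residualSq y z = ‖(orthSpan z).starProjection y‖ ^ 2 := by
  set S := Submodule.span ℂ (Set.range z) with hS
  set q := Sᗮ.starProjection y with hq
  have hqS : q ∈ Sᗮ := Submodule.starProjection_apply_mem _ _
  have hyq : y - q ∈ S := by
    have := Submodule.sub_starProjection_mem_orthogonal (K := Sᗮ) y
    rwa [Submodule.orthogonal_orthogonal] at this
  have hproj : (orthSpan z).starProjection y = q := by
    refine Submodule.eq_starProjection_of_mem_of_inner_eq_zero hqS fun w hw => ?_
    rw [real_inner_eq_re_complex_inner, Submodule.inner_right_of_mem_orthogonal hyq hw,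
      Complex.zero_re]
  rw [hproj]
  set c : Fin (k + 1) → EuclideanSpace ℂ (Fin r) := Fin.cons y z with hc
  set C := columnsMatrix c with hC
  obtain ⟨d, hd⟩ := (Submodule.mem_span_range_iff_exists_fun ℂ).mp hyq
  set x : Fin (k + 1) → ℂ := Fin.cons 1 (fun j => -d j) with hx
  have hcomb : ∀ v : Fin (k + 1) → ℂ, C *ᵥ v = (∑ j, v j • c j : EuclideanSpace ℂ (Fin r)) := by
    intro v
    ext i
    simp [hC, columnsMatrix, Matrix.mulVec, dotProduct, mul_comm]
  have hCx : C *ᵥ x = q := by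
    rw [hcomb]
    congr 1
    rw [Fin.sum_univ_succ]
    simp only [hx, hc, Fin.cons_zero, Fin.cons_succ, one_smul, neg_smul, Finset.sum_neg_distrib, hd]
    abel
  have hCq : Cᴴ *ᵥ (q : Fin r → ℂ) = Pi.single 0 ((‖q‖ ^ 2 : ℝ) : ℂ) := by
    have h1 : ∀ j, (Cᴴ *ᵥ (q : Fin r → ℂ)) j = inner ℂ (c j) q := by
      intro j
      simp [hC, columnsMatrix, Matrix.mulVec, dotProduct, PiLp.inner_apply, mul_comm]
    ext j
    rw [h1]
    refine Fin.cases ?_ (fun j => ?_) j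
    · have : y = (y - q) + q := by abel
      simp only [hc, Fin.cons_zero, Pi.single_eq_same]
      rw [this, inner_add_left, Submodule.inner_right_of_mem_orthogonal hyq hqS, zero_add,
        inner_self_eq_norm_sq_to_K]
      simp
    · simp only [hc, Fin.cons_succ]
      rw [Pi.single_eq_of_ne (Fin.succ_ne_zero j)]
      exact Submodule.inner_right_of_mem_orthogonal 
        (Submodule.subset_span (Set.mem_range_self j)) hqS
  have hG : (Cᴴ * C) *ᵥ x = Pi.single 0 ((‖q‖ ^ 2 : ℝ) : ℂ) := by
    rw [← Matrix.mulVec_mulVec, hCx, hCq]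
  unfold residualSq
  rw [← hc, ← hC]
  by_cases hq0 : q = 0
  -- If y lies in the span, the Gram matrix is singular; its inverse is 0 by convention and 1/0 = 0
  -- agrees with ‖q‖² = 0. Thus no condition on y is needed.
  · have hdet : (Cᴴ * C).det = 0 := by
      refine Matrix.exists_mulVec_eq_zero_iff.mp ⟨x, fun h => ?_, ?_⟩
      · have := congrFun h 0
        simp [hx] at this
      · rw [hG, hq0]; simp
    rw [Matrix.nonsing_inv_apply_not_isUnit _ (by rw [hdet]; exact not_isUnit_zero), hq0]
    simp
  · have hli : LinearIndependent ℂ c := by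
      rw [hc, linearIndependent_finCons]
      refine ⟨hz, fun hy => hq0 ?_⟩
      have : q ∈ S := by
        have := S.sub_mem hy hyq
        rwa [sub_sub_cancel] at this
      have h0 := Submodule.inner_right_of_mem_orthogonal this hqS
      exact inner_self_eq_zero.mp h0
    have hinj : Function.Injective C.mulVec := by
      intro v w hvw
      have h0 : C *ᵥ (v - w) = 0 := by rw [Matrix.mulVec_sub, sub_eq_zero]; exact hvw
      rw [hcomb] at h0
      have h1 : (∑ j, (v - w) j • c j : EuclideanSpace ℂ (Fin r)) = 0 := by
        ext i; exact congrFun h0 i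
      have h2 := Fintype.linearIndependent_iff.mp hli _ h1
      ext j
      exact sub_eq_zero.mp (h2 j)
    have hunit : IsUnit (Cᴴ * C).det :=
      (Matrix.isUnit_iff_isUnit_det _).mp (Matrix.PosDef.conjTranspose_mul_self C hinj).isUnit
    have h1 : x = (Cᴴ * C)⁻¹ *ᵥ Pi.single 0 ((‖q‖ ^ 2 : ℝ) : ℂ) := by
      rw [← hG, Matrix.mulVec_mulVec, Matrix.nonsing_inv_mul _ hunit, Matrix.one_mulVec]
    have h2 := congrFun h1 0
    rw [Matrix.mulVec_single] at h2
    simp only [hx, Fin.cons_zero, Pi.smul_apply, Matrix.col_apply, MulOpposite.smul_eq_mul_unop,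
      MulOpposite.unop_op] at h2
    have h3 := congrArg Complex.re h2
    rw [Complex.re_mul_ofReal, Complex.one_re] at h3
    have hne : ((Cᴴ * C)⁻¹ 0 0).re ≠ 0 := fun h => by simp [h] at h3
    rw [div_eq_iff hne, h3]
    ring

/-- Independent Gaussian vectors, at most as many as the dimension, are almost surely linearly
independent. -/
lemma ae_linearIndependent_stdGaussian {r : ℕ} (k : ℕ) (hk : k ≤ r) :
    ∀ᵐ z ∂(Measure.pi fun _ : Fin k => stdGaussian (EuclideanSpace ℂ (Fin r))),
      LinearIndependent ℂ z := by
  induction k with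
  | zero => exact Filter.Eventually.of_forall fun z => linearIndependent_empty_type
  | succ k ih =>
    have hmp := measurePreserving_piFinSuccAbove
      (fun _ : Fin (k + 1) => stdGaussian (EuclideanSpace ℂ (Fin r))) 0
    have hmeas : MeasurableSet {p : EuclideanSpace ℂ (Fin r) × (Fin k → EuclideanSpace ℂ (Fin r)) |
        LinearIndependent ℂ (Fin.cons p.1 p.2 : Fin (k + 1) → EuclideanSpace ℂ (Fin r))} := by
      have hcont : Continuous
          fun p : EuclideanSpace ℂ (Fin r) × (Fin k → EuclideanSpace ℂ (Fin r)) =>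
            (Fin.cons p.1 p.2 : Fin (k + 1) → EuclideanSpace ℂ (Fin r)) := by
        refine continuous_pi fun i => ?_
        refine Fin.cases ?_ (fun i => ?_) i
        · simpa using continuous_fst
        · simpa [Function.comp_def] using (continuous_apply i).comp continuous_snd
      exact (isOpen_setOfPred_linearIndependent.preimage hcont).measurableSet
    have key : ∀ᵐ p ∂((stdGaussian (EuclideanSpace ℂ (Fin r))).prod
        (Measure.pi fun _ : Fin k => stdGaussian (EuclideanSpace ℂ (Fin r)))),
        LinearIndependent ℂ (Fin.cons p.1 p.2 : Fin (k + 1) → EuclideanSpace ℂ (Fin r)) := by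
      -- The order is swapped so that the k independent vectors are fixed first. Their span is
      -- proper, hence lies in a hyperplane u^⊥, which the new vector avoids almost surely.
      rw [Measure.ae_prod_iff_ae_ae hmeas, Measure.ae_ae_comm hmeas]
      filter_upwards [ih (by omega)] with z hz
      have hne : Submodule.span ℂ (Set.range z) ≠ ⊤ := by
        intro h
        have h1 := finrank_span_eq_card hz
        rw [h, finrank_top, finrank_euclideanSpace, Fintype.card_fin, Fintype.card_fin] at h1
        omega
      obtain ⟨u, hu, hu0⟩ := (Submodule.ne_bot_iff _).mp
        (mt Submodule.orthogonal_eq_bot_iff.mp hne)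
      have hnull := stdGaussian_inner_eq_null hu0 0
      rw [ae_iff]
      refine measure_mono_null (fun g hg => ?_) hnull
      simp only [linearIndependent_finCons, hz, true_and, not_not, Set.mem_ofPred_eq] at hg ⊢
      rw [real_inner_eq_re_complex_inner, Submodule.inner_left_of_mem_orthogonal hg hu,
        Complex.zero_re]
    have h2 := hmp.quasiMeasurePreserving.ae key
    filter_upwards [h2] with z hz
    convert hz using 1
    ext1 i
    refine Fin.cases ?_ (fun i => ?_) i <;> rfl

/-! ### Moments of the squared distance to a random subspace -/

lemma ascPochhammer_eval_natCast_succ (M n : ℕ) :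
    (ascPochhammer ℝ n).eval ((M + 1 : ℕ) : ℝ) = ((M + n).factorial : ℝ) / M.factorial := by
  rw [eq_div_iff (by positivity), ← ascPochhammer_eval_cast, ascPochhammer_nat_eq_ascFactorial,
    mul_comm]
  exact_mod_cast Nat.factorial_mul_ascFactorial M n

lemma lintegral_pow_mul_gammaDensity {N : ℕ} (hN : 1 ≤ N) (n : ℕ) :
    ∫⁻ t in Set.Ici 0, ENNReal.ofReal (t ^ n) * ENNReal.ofReal (gammaDensity N 1 t) =
      ENNReal.ofReal ((ascPochhammer ℝ n).eval (N : ℝ)) := by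
  obtain ⟨M, rfl⟩ : ∃ M, N = M + 1 := ⟨N - 1, by omega⟩
  have h : ∀ t ∈ Set.Ioi (0 : ℝ), ENNReal.ofReal (t ^ n) * ENNReal.ofReal (gammaDensity (M + 1) 1 t) =
      ENNReal.ofReal (1 / M.factorial * (t ^ (M + n) * Real.exp (-(1 * t)))) := by
    intro t ht
    rw [← ENNReal.ofReal_mul (pow_nonneg (le_of_lt ht) n)]
    congr 1
    unfold gammaDensity
    rw [Nat.add_sub_cancel, pow_add]
    simp only [div_one, one_pow, mul_one, one_mul]
    ring
  rw [Measure.restrict_congr_set Ioi_ae_eq_Ici.symm, setLIntegral_congr_fun measurableSet_Ioi h,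
    ← ofReal_integral_eq_lintegral_ofReal
      ((integrableOn_pow_mul_exp_neg_mul (M + n) one_pos).const_mul _), integral_const_mul,
    integral_pow_mul_exp_neg_mul _ one_pos, ascPochhammer_eval_natCast_succ]
  · congr 1
    simp only [one_pow, div_one]
    ring
  · filter_upwards [ae_restrict_mem measurableSet_Ioi] with t ht
    have : (0 : ℝ) < t := ht
    simp only [Pi.zero_apply]
    positivity

lemma lintegral_normSq_starProjection_pow {F : Type*} [NormedAddCommGroup F]
    [InnerProductSpace ℝ F] [FiniteDimensional ℝ F] [MeasurableSpace F] [BorelSpace F]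
    {N : ℕ} (hN : 1 ≤ N) {W : Submodule ℝ F} (hW : Module.finrank ℝ W = 2 * N) (n : ℕ) :
    ∫⁻ g, ENNReal.ofReal ((‖W.starProjection g‖ ^ 2 / 2) ^ n) ∂(stdGaussian F) =
      ENNReal.ofReal ((ascPochhammer ℝ n).eval (N : ℝ)) := by
  have h := map_normSq_starProjection_stdGaussian hN hW 0 one_pos
  simp only [zero_add, one_mul, map_zero, norm_zero, ne_eq, OfNat.ofNat_ne_zero,
    not_false_eq_true, zero_pow, zero_div, ncGammaDensity_zero] at h
  have h1 : ∫⁻ t, ENNReal.ofReal (t ^ n)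
      ∂((stdGaussian F).map fun g => ‖W.starProjection g‖ ^ 2 / 2) =
      ∫⁻ g, ENNReal.ofReal ((‖W.starProjection g‖ ^ 2 / 2) ^ n) ∂(stdGaussian F) :=
    lintegral_map (by fun_prop) (by fun_prop)
  have hm : Measurable fun t => ENNReal.ofReal (gammaDensity N 1 t) :=
    (continuous_gammaDensity N 1).measurable.ennreal_ofReal
  rw [← h1, h, lintegral_withDensity_eq_lintegral_mul _ hm (by fun_prop),
    ← lintegral_pow_mul_gammaDensity hN n]
  refine lintegral_congr fun t => ?_
  simp only [Pi.mul_apply]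
  rw [mul_comm]

/-- Each unit vector starts an orthonormal basis, and the unitary map matching the two bases does
the job. -/
lemma exists_linearIsometryEquiv_apply_eq {r : ℕ} {u v : EuclideanSpace ℂ (Fin r)}
    (hu : ‖u‖ = 1) (hv : ‖v‖ = 1) :
    ∃ U : EuclideanSpace ℂ (Fin r) ≃ₗᵢ[ℂ] EuclideanSpace ℂ (Fin r), U u = v := by
  have hr : 0 < r := by
    rcases Nat.eq_zero_or_pos r with rfl | h
    · have : u = 0 := by ext i; exact i.elim0
      simp [this] at hu
    · exact h
  have hb : ∀ w : EuclideanSpace ℂ (Fin r), ‖w‖ = 1 →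
      ∃ b : OrthonormalBasis (Fin r) ℂ (EuclideanSpace ℂ (Fin r)), b ⟨0, hr⟩ = w := by
    intro w hw
    obtain ⟨b, hb⟩ := Orthonormal.exists_orthonormalBasis_extension_of_card_eq (ι := Fin r)
      (𝕜 := ℂ) (E := EuclideanSpace ℂ (Fin r)) (by simp) (v := fun _ => w) (s := {⟨0, hr⟩})
      (by
        refine ⟨fun i => hw, fun i j hij => absurd (Subsingleton.elim i j) hij⟩)
    exact ⟨b, hb _ rfl⟩
  obtain ⟨b, hb1⟩ := hb u hu
  obtain ⟨c, hc1⟩ := hb v hv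
  exact ⟨b.equiv c (Equiv.refl _), by rw [← hb1, OrthonormalBasis.equiv_apply_basis]; simpa using hc1⟩

lemma measurePreserving_isometry_stdGaussian {r : ℕ}
    (U : EuclideanSpace ℂ (Fin r) ≃ₗᵢ[ℂ] EuclideanSpace ℂ (Fin r)) :
    (stdGaussian (EuclideanSpace ℂ (Fin r))).map U = stdGaussian (EuclideanSpace ℂ (Fin r)) :=
  stdGaussian_map (⟨U.toLinearEquiv.restrictScalars ℝ, U.norm_map⟩ :
    EuclideanSpace ℂ (Fin r) ≃ₗᵢ[ℝ] EuclideanSpace ℂ (Fin r))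

/-- As a function of m, the moment is homogeneous of degree 2n and unitarily invariant, so it is a
constant multiple of (‖m‖²/2)ⁿ. The constant is found by averaging over Gaussian m. These are the
moments of ‖m‖²/2 times a beta variable with parameters r - k and k when k > 0. -/
theorem lintegral_residualSq_pow {k r : ℕ} (hk : k < r) (n : ℕ) (m : EuclideanSpace ℂ (Fin r)) :
    ∫⁻ z, ENNReal.ofReal ((residualSq m z / 2) ^ n)
      ∂(Measure.pi fun _ : Fin k => stdGaussian (EuclideanSpace ℂ (Fin r))) =
    ENNReal.ofReal ((ascPochhammer ℝ n).eval ((r - k : ℕ) : ℝ) /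
      (ascPochhammer ℝ n).eval (r : ℝ) * (‖m‖ ^ 2 / 2) ^ n) := by
  set μ := Measure.pi fun _ : Fin k => stdGaussian (EuclideanSpace ℂ (Fin r)) with hμ
  set F : EuclideanSpace ℂ (Fin r) → ENNReal :=
    fun u => ∫⁻ z, ENNReal.ofReal ((residualSq u z / 2) ^ n) ∂μ with hF
  have hli := ae_linearIndependent_stdGaussian (r := r) k hk.le
  have hhom : ∀ (c : ℝ) u, F (c • u) = ENNReal.ofReal ((c ^ 2) ^ n) * F u := by
    intro c u
    simp only [hF]
    rw [← lintegral_const_mul' _ _ ENNReal.ofReal_ne_top]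
    refine lintegral_congr_ae ?_
    filter_upwards [hli] with z hz
    rw [← ENNReal.ofReal_mul (by positivity), residualSq_eq hz, residualSq_eq hz, map_smul,
      norm_smul, mul_pow, Real.norm_eq_abs, sq_abs, ← mul_pow]
    congr 2; ring
  have hrot : ∀ (U : EuclideanSpace ℂ (Fin r) ≃ₗᵢ[ℂ] EuclideanSpace ℂ (Fin r)) u,
      F (U u) = F u := by
    intro U u
    have hmap : μ.map (fun z j => U (z j)) = μ := by
      have h := Measure.pi_map_pi (ι := Fin k) (μ := fun _ => stdGaussian (EuclideanSpace ℂ (Fin r)))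
        (f := fun _ => U) (hμ := fun _ => by
          rw [measurePreserving_isometry_stdGaussian]; infer_instance) (fun _ => by fun_prop)
      simp_rw [measurePreserving_isometry_stdGaussian] at h
      exact h
    have hmeas : Measurable fun z : Fin k → EuclideanSpace ℂ (Fin r) =>
        ENNReal.ofReal ((residualSq (U u) z / 2) ^ n) := by
      have := measurable_residualSq (k := k) (r := r) |>.comp (measurable_prodMk_left (x := U u))
      exact ((this.div_const 2).pow_const n).ennreal_ofReal
    simp only [hF]
    conv_lhs => rw [← hmap]
    rw [lintegral_map hmeas (by fun_prop)]
    simp_rw [residualSq_isometry]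
  obtain ⟨e, he⟩ : ∃ e : EuclideanSpace ℂ (Fin r), ‖e‖ = 1 :=
    ⟨EuclideanSpace.single ⟨0, by omega⟩ 1, by simp⟩
  set κ := ENNReal.ofReal (2 ^ n) * F e with hκ
  have hFu : ∀ u, F u = ENNReal.ofReal ((‖u‖ ^ 2 / 2) ^ n) * κ := by
    intro u
    obtain ⟨v, hv, huv⟩ : ∃ v : EuclideanSpace ℂ (Fin r), ‖v‖ = 1 ∧ u = ‖u‖ • v := by
      by_cases hu : u = 0
      · exact ⟨e, he, by simp [hu]⟩
      · have : ‖u‖ ≠ 0 := norm_ne_zero_iff.mpr hu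
        refine ⟨‖u‖⁻¹ • u, ?_, ?_⟩
        · rw [norm_smul, norm_inv, norm_norm, inv_mul_cancel₀ this]
        · rw [smul_smul, mul_inv_cancel₀ this, one_smul]
    obtain ⟨U, hU⟩ := exists_linearIsometryEquiv_apply_eq he hv
    have h1 : F u = ENNReal.ofReal ((‖u‖ ^ 2) ^ n) * F v := by
      conv_lhs => rw [huv]
      exact hhom _ _
    rw [h1, ← hU, hrot, hκ, ← mul_assoc, ← ENNReal.ofReal_mul (by positivity), ← mul_pow]
    congr 3; ring
  have htop : Module.finrank ℝ (⊤ : Submodule ℝ (EuclideanSpace ℂ (Fin r))) = 2 * r := by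
    rw [finrank_top]
    have := Module.finrank_mul_finrank ℝ ℂ (EuclideanSpace ℂ (Fin r))
    rw [Complex.finrank_real_complex, finrank_euclideanSpace, Fintype.card_fin] at this
    exact this.symm
  have hpoch : 0 < (ascPochhammer ℝ n).eval (r : ℝ) :=
    ascPochhammer_pos n _ (by exact_mod_cast (by omega : 0 < r))
  -- First evaluation of the double integral: radial dependence of F and the moments of ‖u‖²/2,
  -- gamma with shape r.
  have hI1 : ∫⁻ u, F u ∂(stdGaussian (EuclideanSpace ℂ (Fin r))) =
      ENNReal.ofReal ((ascPochhammer ℝ n).eval (r : ℝ)) * κ := by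
    simp_rw [hFu]
    rw [lintegral_mul_const _ (by fun_prop),
      ← lintegral_normSq_starProjection_pow (by omega) htop n]
    simp_rw [Submodule.starProjection_eq_self_iff.mpr Submodule.mem_top]
  -- Second evaluation: for fixed z, half the squared projection of u is gamma with shape r - k,
  -- whatever z is.
  have hI2 : ∫⁻ u, F u ∂(stdGaussian (EuclideanSpace ℂ (Fin r))) =
      ENNReal.ofReal ((ascPochhammer ℝ n).eval ((r - k : ℕ) : ℝ)) := by
    simp only [hF]
    rw [lintegral_lintegral_swap]
    · have : ∀ᵐ z ∂μ, ∫⁻ u, ENNReal.ofReal ((residualSq u z / 2) ^ n)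
          ∂(stdGaussian (EuclideanSpace ℂ (Fin r))) =
          ENNReal.ofReal ((ascPochhammer ℝ n).eval ((r - k : ℕ) : ℝ)) := by
        filter_upwards [hli] with z hz
        simp_rw [residualSq_eq hz]
        exact lintegral_normSq_starProjection_pow (by omega) (finrank_orthSpan hz) n
      rw [lintegral_congr_ae this]
      simp
    · exact ((measurable_residualSq.div_const 2).pow_const n).ennreal_ofReal.aemeasurable
  have hκ2 : κ = ENNReal.ofReal ((ascPochhammer ℝ n).eval ((r - k : ℕ) : ℝ) /
      (ascPochhammer ℝ n).eval (r : ℝ)) := by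
    rw [ENNReal.ofReal_div_of_pos hpoch, ENNReal.eq_div_iff (by simpa using hpoch)
      ENNReal.ofReal_ne_top, ← hI1, hI2]
  rw [show ∫⁻ z, ENNReal.ofReal ((residualSq m z / 2) ^ n) ∂μ = F m from rfl, hFu, hκ2, mul_comm,
    ← ENNReal.ofReal_mul' (by positivity)]

/-! ### Whitening of the fading matrix -/

section

variable {Ω ι : Type*} [MeasurableSpace Ω] [Fintype ι] {X : Ω → ι → ℂ} {S : Matrix ι ι ℂ}
  {P : Measure Ω}

lemma IsComplexGaussian.memLp_two (hX : IsComplexGaussian X 0 S P) (p : ι) :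
    MemLp (fun ω => X ω p) 2 P :=
  (HasGaussianLaw.eval (X := fun p ω => X ω p) hX.hasGaussianLaw p).memLp_two

lemma IsComplexGaussian.integral_re_sum (hX : IsComplexGaussian X 0 S P) (d : ι → ℂ) :
    ∫ ω, (∑ p, d p * X ω p).re ∂P = 0 := by
  have := hX.hasGaussianLaw.isProbabilityMeasure
  have hint : ∀ p, Integrable (fun ω => d p * X ω p) P := fun p =>
    ((hX.memLp_two p).integrable (by norm_num)).const_mul _
  have h1 := integral_re (integrable_finsetSum Finset.univ fun p _ => hint p)
  simp only [RCLike.re_to_complex] at h1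
  rw [h1, integral_finsetSum _ fun p _ => hint p]
  simp [integral_const_mul, hX.mean]

/-- From (Re w)² = Re(w w̄ + w²)/2: circular symmetry removes the w² part and the covariance gives
the other. -/
lemma IsComplexGaussian.integral_sq_re_sum (hX : IsComplexGaussian X 0 S P) (d : ι → ℂ) :
    ∫ ω, (∑ p, d p * X ω p).re ^ 2 ∂P = (∑ p, ∑ q, d p * conj (d q) * S p q).re / 2 := by
  have hmul : ∀ p q, Integrable (fun ω => X ω p * X ω q) P := fun p q =>
    (hX.memLp_two p).integrable_mul (hX.memLp_two q)
  have hmulc : ∀ p q, Integrable (fun ω => X ω p * conj (X ω q)) P := fun p q =>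
    (hX.memLp_two p).integrable_mul (hX.memLp_two q).star
  have key : ∀ ω, (∑ p, d p * X ω p).re ^ 2 =
      (∑ p, ∑ q, (d p * conj (d q) * (X ω p * conj (X ω q)) + d p * d q * (X ω p * X ω q))).re / 2 := by
    intro ω
    have h1 : ∑ p, ∑ q, (d p * conj (d q) * (X ω p * conj (X ω q)) + d p * d q * (X ω p * X ω q)) =
        (∑ p, d p * X ω p) * conj (∑ p, d p * X ω p) +
        (∑ p, d p * X ω p) * (∑ p, d p * X ω p) := by
      simp_rw [map_sum, Finset.sum_mul_sum, ← Finset.sum_add_distrib, map_mul]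
      refine Finset.sum_congr rfl fun p _ => Finset.sum_congr rfl fun q _ => ?_
      ring
    rw [h1]
    simp only [Complex.add_re, Complex.mul_re, Complex.conj_re, Complex.conj_im]
    ring
  simp_rw [key]
  have hint : ∀ p q, Integrable (fun ω => d p * conj (d q) * (X ω p * conj (X ω q)) +
      d p * d q * (X ω p * X ω q)) P := fun p q =>
    ((hmulc p q).const_mul _).add ((hmul p q).const_mul _)
  have hint2 : ∀ p, Integrable (fun ω => ∑ q, (d p * conj (d q) * (X ω p * conj (X ω q)) +
      d p * d q * (X ω p * X ω q))) P := fun p => integrable_finsetSum _ fun q _ => hint p q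
  have h1 := integral_re (integrable_finsetSum Finset.univ fun p _ => hint2 p)
  simp only [RCLike.re_to_complex] at h1
  rw [integral_div, h1, integral_finsetSum _ fun p _ => hint2 p]
  congr 2
  refine Finset.sum_congr rfl fun p _ => ?_
  rw [integral_finsetSum _ fun q _ => hint p q]
  refine Finset.sum_congr rfl fun q _ => ?_
  rw [integral_add ((hmulc p q).const_mul _) ((hmul p q).const_mul _), integral_const_mul,
    integral_const_mul]
  have hc := hX.covariance p q
  have hp := hX.pseudoCovariance p q
  simp only [Pi.zero_apply, sub_zero] at hc hp
  rw [hc, hp, mul_zero, add_zero]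

end

section

open scoped MatrixOrder Matrix.Norms.L2Operator

lemma exists_eq_conjTranspose_mul_self {k : ℕ} {A : Matrix (Fin k) (Fin k) ℂ}
    (hA : A.PosSemidef) : ∃ B : Matrix (Fin k) (Fin k) ℂ, A = Bᴴ * B :=
  CStarAlgebra.nonneg_iff_eq_star_mul_self.mp hA.nonneg

end

/-- A positive definite `R` is whitened by a matrix whose first row is supported on the first
column. -/
lemma exists_whitening {k : ℕ} {R : Matrix (Fin (k + 1)) (Fin (k + 1)) ℂ} (hR : R.PosDef) :
    0 < (R⁻¹ 0 0).re ∧ ∃ M : Matrix (Fin (k + 1)) (Fin (k + 1)) ℂ, Mᴴ * R * M = 1 ∧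
      ∀ j, M 0 j = if j = 0 then ((√(R⁻¹ 0 0).re : ℝ) : ℂ) else 0 := by
  have hρ : 0 < (R⁻¹ 0 0).re := (Complex.pos_iff.mp (hR.inv.diag_pos (i := 0))).1
  refine ⟨hρ, ?_⟩
  obtain ⟨B, hB⟩ := exists_eq_conjTranspose_mul_self hR.inv.posSemidef
  have hdet : IsUnit (Bᴴ * B).det := by
    rw [← hB]; exact (Matrix.isUnit_iff_isUnit_det _).mp hR.inv.isUnit
  rw [Matrix.det_mul, IsUnit.mul_iff] at hdet
  have hRB : R = B⁻¹ * Bᴴ⁻¹ := by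
    rw [← Matrix.mul_inv_rev, ← hB, Matrix.nonsing_inv_nonsing_inv _
      ((Matrix.isUnit_iff_isUnit_det _).mp hR.isUnit)]
  -- With R⁻¹ = BᴴB, every M = BᴴV with V unitary whitens R. Its first row is (⟨w, b_j⟩)_j for w the
  -- first column of B and b_j the columns of V, so V is chosen with b₀ = w/‖w‖, where ‖w‖² =
  -- [R⁻¹]₀₀.
  set w : EuclideanSpace ℂ (Fin (k + 1)) := WithLp.toLp 2 fun i => B i 0 with hw
  have hnorm : ‖w‖ ^ 2 = (R⁻¹ 0 0).re := by
    rw [EuclideanSpace.norm_sq_eq, hB, Matrix.mul_apply, Complex.re_sum]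
    refine Finset.sum_congr rfl fun i _ => ?_
    simp only [hw, Matrix.conjTranspose_apply, Complex.star_def]
    rw [← Complex.normSq_eq_conj_mul_self, Complex.ofReal_re, Complex.normSq_eq_norm_sq]
  have hnw : ‖w‖ = √(R⁻¹ 0 0).re := by rw [← hnorm, Real.sqrt_sq (norm_nonneg _)]
  have hw0 : ‖w‖ ≠ 0 := by rw [hnw]; exact (Real.sqrt_pos.mpr hρ).ne'
  obtain ⟨b, hb⟩ := Orthonormal.exists_orthonormalBasis_extension_of_card_eq (ι := Fin (k + 1))
    (𝕜 := ℂ) (E := EuclideanSpace ℂ (Fin (k + 1))) (by simp)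
    (v := fun _ => ((‖w‖ : ℝ) : ℂ)⁻¹ • w) (s := {0})
    ⟨fun i => by
      simp only [Set.domRestrict_apply]
      rw [norm_smul, norm_inv, Complex.norm_real, norm_norm, inv_mul_cancel₀ hw0],
      fun i j hij => absurd (Subsingleton.elim i j) hij⟩
  have hb0 : w = ((‖w‖ : ℝ) : ℂ) • b 0 := by
    rw [hb 0 rfl, smul_smul, mul_inv_cancel₀ (by exact_mod_cast hw0), one_smul]
  set V := columnsMatrix b with hV
  have hVV : Vᴴ * V = 1 := by
    ext i j
    rw [conjTranspose_columnsMatrix_mul_apply, orthonormal_iff_ite.mp b.orthonormal,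
      Matrix.one_apply]
  refine ⟨Bᴴ * V, ?_, fun j => ?_⟩
  · rw [Matrix.conjTranspose_mul, Matrix.conjTranspose_conjTranspose, hRB]
    calc Vᴴ * B * (B⁻¹ * Bᴴ⁻¹) * (Bᴴ * V)
        = Vᴴ * (B * B⁻¹) * (Bᴴ⁻¹ * Bᴴ) * V := by simp only [Matrix.mul_assoc]
      _ = 1 := by
        rw [Matrix.mul_nonsing_inv _ hdet.2, Matrix.nonsing_inv_mul _ hdet.1, Matrix.mul_one,
          Matrix.mul_one, hVV]
  · have h1 : (Bᴴ * V) 0 j = inner ℂ w (b j) := by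
      simp [Matrix.mul_apply, hV, columnsMatrix, hw, PiLp.inner_apply, mul_comm]
    rw [h1, hb0, inner_smul_left, orthonormal_iff_ite.mp b.orthonormal, Complex.conj_ofReal, hnw]
    by_cases hj : j = 0
    · simp [hj]
    · rw [if_neg hj, if_neg (Ne.symm hj), mul_zero]

/-- The columns of `√2 H M`. -/
noncomputable def whitenedColumns {NR NT : ℕ} (M : Matrix (Fin NT) (Fin NT) ℂ)
    (H : Matrix (Fin NR) (Fin NT) ℂ) (j : Fin NT) : EuclideanSpace ℂ (Fin NR) :=
  WithLp.toLp 2 fun i => ((√2 : ℝ) : ℂ) * (H * M) i j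

/-- Both laws are centred Gaussian, so it suffices to compare variances of real linear functionals.
The factor √2 compensates for the variance 1/2 of the real and imaginary parts of a unit complex
Gaussian. -/
theorem hasLaw_whitenedColumns {Ω : Type*} [MeasurableSpace Ω] {P : Measure Ω} {NR NT : ℕ}
    {Hrn : Ω → Matrix (Fin NR) (Fin NT) ℂ} {R M : Matrix (Fin NT) (Fin NT) ℂ}
    (h : IsTransmitCorrelatedFading Hrn R P) (hM : Mᴴ * R * M = 1) :
    AEMeasurable (fun ω => whitenedColumns M (Hrn ω)) P ∧
    P.map (fun ω => whitenedColumns M (Hrn ω)) =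
      Measure.pi fun _ : Fin NT => stdGaussian (EuclideanSpace ℂ (Fin NR)) := by
  -- Gaussianity is given for the conjugated entries, so the map to the whitened columns is only
  -- real-linear.
  set T : (Fin NR × Fin NT → ℂ) →ₗ[ℝ] (Fin NT → EuclideanSpace ℂ (Fin NR)) :=
    { toFun := fun x j => WithLp.toLp 2 fun i => ((√2 : ℝ) : ℂ) * ∑ l, conj (x (i, l)) * M l j
      map_add' := fun x y => by
        ext j i
        simp [add_mul, Finset.sum_add_distrib, mul_add]
      map_smul' := fun c x => by
        ext j i
        simp only [Pi.smul_apply, Complex.real_smul, map_mul, Complex.conj_ofReal,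
          RingHom.id_apply, PiLp.smul_apply]
        simp_rw [mul_assoc]
        rw [← Finset.mul_sum]
        ring } with hT
  have hTX : (fun ω => whitenedColumns M (Hrn ω)) =
      fun ω => (LinearMap.toContinuousLinearMap T) (fun p => conj (Hrn ω p.1 p.2)) := by
    ext ω j i
    simp [hT, whitenedColumns, Matrix.mul_apply]
  unfold IsTransmitCorrelatedFading at h
  have hP := h.hasGaussianLaw.isProbabilityMeasure
  have hG : HasGaussianLaw (fun ω => whitenedColumns M (Hrn ω)) P := by
    rw [hTX]; exact h.hasGaussianLaw.map_fun _
  have hGi := hG.isGaussian_map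
  refine ⟨hG.aemeasurable, Measure.ext_of_charFunDual (funext fun L => ?_)⟩
  rw [charFunDual_pi, hG.charFunDual_map_eq]
  set ℓ : Fin NT → EuclideanSpace ℂ (Fin NR) := fun j =>
    (InnerProductSpace.toDual ℝ _).symm (L.comp (.single ℝ (fun _ => EuclideanSpace ℂ (Fin NR)) j))
    with hℓ
  have hnorm : ∀ j, ‖L.comp (.single ℝ (fun _ => EuclideanSpace ℂ (Fin NR)) j)‖ = ‖ℓ j‖ := fun j =>
    (LinearIsometryEquiv.norm_map _ _).symm
  -- Coefficients expressing the functional as Re ∑ d_p · conj(H_p), the form handled by the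
  -- second-moment lemma.
  set d : Fin NR × Fin NT → ℂ := fun p => ((√2 : ℝ) : ℂ) * ∑ j, ℓ j p.1 * conj (M p.2 j) with hd
  have hLd : ∀ ω, L (whitenedColumns M (Hrn ω)) = (∑ p, d p * conj (Hrn ω p.1 p.2)).re := by
    intro ω
    rw [← L.sum_comp_single]
    have h1 : ∀ j, L.comp (.single ℝ (fun _ => EuclideanSpace ℂ (Fin NR)) j)
        (whitenedColumns M (Hrn ω) j) =
        (∑ i, ∑ l, ((√2 : ℝ) : ℂ) * (ℓ j i * conj (M l j)) * conj (Hrn ω i l)).re := by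
      intro j
      have h2 : L.comp (.single ℝ (fun _ => EuclideanSpace ℂ (Fin NR)) j)
          (whitenedColumns M (Hrn ω) j) = inner ℝ (ℓ j) (whitenedColumns M (Hrn ω) j) := by
        rw [hℓ, InnerProductSpace.toDual_symm_apply]
      rw [h2, real_inner_comm, real_inner_eq_re_complex_inner, PiLp.inner_apply]
      congr 1
      refine Finset.sum_congr rfl fun i _ => ?_
      simp only [whitenedColumns, Matrix.mul_apply, RCLike.inner_apply, map_mul, map_sum,
        Complex.conj_ofReal, Finset.mul_sum]
      refine Finset.sum_congr rfl fun l _ => ?_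
      ring
    rw [Finset.sum_congr rfl fun j _ => h1 j, ← Complex.re_sum]
    congr 1
    rw [Finset.sum_comm, Fintype.sum_prod_type]
    refine Finset.sum_congr rfl fun i _ => ?_
    rw [Finset.sum_comm]
    refine Finset.sum_congr rfl fun l _ => ?_
    simp only [hd]
    rw [Finset.mul_sum, Finset.sum_mul]
  have hmean : ∫ ω, L (whitenedColumns M (Hrn ω)) ∂P = 0 := by
    simp_rw [hLd]
    exact h.integral_re_sum d
  have hMe : ∀ j j' : Fin NT, ∑ l, ∑ l', conj (M l j) * M l' j' * R l l' = if j = j' then 1 else 0 := by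
    intro j j'
    have := congrFun (congrFun hM j) j'
    rw [Matrix.one_apply] at this
    rw [← this, Matrix.mul_apply, Finset.sum_comm]
    refine Finset.sum_congr rfl fun l' _ => ?_
    rw [Matrix.mul_apply, Finset.sum_mul]
    refine Finset.sum_congr rfl fun l _ => ?_
    simp only [Matrix.conjTranspose_apply, Complex.star_def]
    ring
  have hvar : Var[fun ω => L (whitenedColumns M (Hrn ω)); P] = ∑ j, ‖ℓ j‖ ^ 2 := by
    refine (variance_of_integral_eq_zero (X := fun ω => L (whitenedColumns M (Hrn ω)))
      (L.continuous.measurable.comp_aemeasurable hG.aemeasurable) hmean).trans ?_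
    simp_rw [hLd]
    rw [h.integral_sq_re_sum d]
    have hs : ∑ p, ∑ q, d p * conj (d q) * ((1 : Matrix (Fin NR) (Fin NR) ℂ) ⊗ₖ R) p q =
        ((2 * ∑ j, ‖ℓ j‖ ^ 2 : ℝ) : ℂ) := by
      have e1 : ∀ i, ∑ l, ∑ l', d (i, l) * conj (d (i, l')) * R l l' =
          2 * ∑ j, ((‖ℓ j i‖ ^ 2 : ℝ) : ℂ) := by
        intro i
        have e2 : ∀ l l', d (i, l) * conj (d (i, l')) * R l l' =
            ∑ j, ∑ j', 2 * (ℓ j i * conj (ℓ j' i)) * (conj (M l j) * M l' j' * R l l') := by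
          intro l l'
          have s2 : ((√2 : ℝ) : ℂ) * ((√2 : ℝ) : ℂ) = 2 := by
            rw [← Complex.ofReal_mul, Real.mul_self_sqrt (by norm_num)]; norm_num
          simp only [hd, map_mul, map_sum, Complex.conj_ofReal, Complex.conj_conj]
          have : ∀ A B C : ℂ, ((√2 : ℝ) : ℂ) * A * (((√2 : ℝ) : ℂ) * B) * C =
              2 * (A * B * C) := fun A B C => by rw [← s2]; ring
          rw [this, Finset.sum_mul_sum, Finset.sum_mul, Finset.mul_sum]
          refine Finset.sum_congr rfl fun j _ => ?_
          rw [Finset.sum_mul, Finset.mul_sum]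
          refine Finset.sum_congr rfl fun j' _ => ?_
          ring
        simp_rw [e2]
        have e3 : ∑ l, ∑ l', ∑ j, ∑ j',
            2 * (ℓ j i * conj (ℓ j' i)) * (conj (M l j) * M l' j' * R l l') =
            ∑ j, ∑ j', 2 * (ℓ j i * conj (ℓ j' i)) * ∑ l, ∑ l', conj (M l j) * M l' j' * R l l' := by
          simp_rw [Finset.mul_sum]
          calc _ = ∑ l, ∑ j, ∑ l', ∑ j',
                2 * (ℓ j i * conj (ℓ j' i)) * (conj (M l j) * M l' j' * R l l') :=
                Finset.sum_congr rfl fun l _ => Finset.sum_comm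
            _ = ∑ j, ∑ l, ∑ l', ∑ j',
                2 * (ℓ j i * conj (ℓ j' i)) * (conj (M l j) * M l' j' * R l l') := Finset.sum_comm
            _ = ∑ j, ∑ l, ∑ j', ∑ l',
                2 * (ℓ j i * conj (ℓ j' i)) * (conj (M l j) * M l' j' * R l l') :=
                Finset.sum_congr rfl fun j _ => Finset.sum_congr rfl fun l _ => Finset.sum_comm
            _ = _ := Finset.sum_congr rfl fun j _ => Finset.sum_comm
        rw [e3]
        simp_rw [hMe]
        simp only [mul_ite, mul_one, mul_zero, Finset.sum_ite_eq, Finset.mem_univ, if_true,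
          Finset.mul_sum]
        refine Finset.sum_congr rfl fun j _ => ?_
        rw [Complex.mul_conj, Complex.normSq_eq_norm_sq]
      rw [Fintype.sum_prod_type]
      have e4 : ∀ i l, ∑ q, d (i, l) * conj (d q) * ((1 : Matrix (Fin NR) (Fin NR) ℂ) ⊗ₖ R) (i, l) q =
          ∑ l', d (i, l) * conj (d (i, l')) * R l l' := by
        intro i l
        rw [Fintype.sum_prod_type, Finset.sum_eq_single i]
        · simp [Matrix.kroneckerMap_apply]
        · intro i' _ hi'
          simp [Matrix.kroneckerMap_apply, Matrix.one_apply_ne hi'.symm]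
        · simp
      simp_rw [e4, e1]
      rw [← Finset.mul_sum, Finset.sum_comm]
      push_cast
      congr 1
      refine Finset.sum_congr rfl fun j _ => ?_
      rw [← Complex.ofReal_pow, EuclideanSpace.norm_sq_eq]
      push_cast
      rfl
    rw [hs, Complex.ofReal_re]
    ring
  simp_rw [charFunDual_stdGaussian, hnorm]
  rw [← Complex.exp_sum]
  have e1 : P[L ∘ fun ω => whitenedColumns M (Hrn ω)] = 0 := hmean
  have e2 : Var[L ∘ fun ω => whitenedColumns M (Hrn ω); P] = ∑ j, ‖ℓ j‖ ^ 2 := hvar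
  rw [e1, e2]
  congr 1
  push_cast
  rw [zero_mul, zero_sub, Finset.sum_div, ← Finset.sum_neg_distrib]
  refine Finset.sum_congr rfl fun j _ => ?_
  ring

/-! ### The series for the density and its termwise integration -/

/-- The alternating combination of gamma densities in the `n`-th term of the density series. -/
noncomputable def gammaAlternatingSum (N : ℕ) (Γ t : ℝ) (n : ℕ) : ℝ :=
  ∑ m ∈ Finset.range (n + 1), (n.choose m : ℝ) * (-1) ^ m * gammaDensity (N + n - m) Γ t

lemma abs_sum_choose_neg_one_pow_mul_le (n : ℕ) {f : ℕ → ℝ} {C : ℝ}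
    (hf : ∀ m ∈ Finset.range (n + 1), |f m| ≤ C) :
    |∑ m ∈ Finset.range (n + 1), (n.choose m : ℝ) * (-1) ^ m * f m| ≤ 2 ^ n * C := by
  calc |∑ m ∈ Finset.range (n + 1), (n.choose m : ℝ) * (-1) ^ m * f m|
      ≤ ∑ m ∈ Finset.range (n + 1), |(n.choose m : ℝ) * (-1) ^ m * f m| :=
        Finset.abs_sum_le_sum_abs _ _
    _ ≤ ∑ m ∈ Finset.range (n + 1), (n.choose m : ℝ) * C := by
        refine Finset.sum_le_sum fun m hm => ?_
        rw [abs_mul, abs_mul, abs_pow, abs_neg, abs_one, one_pow, mul_one, Nat.abs_cast]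
        exact mul_le_mul_of_nonneg_left (hf m hm) (Nat.cast_nonneg _)
    _ = 2 ^ n * C := by
        rw [← Finset.sum_mul]
        congr 1
        exact_mod_cast Nat.sum_range_choose n

lemma abs_gammaAlternatingSum_le {N : ℕ} (hN : 1 ≤ N) {Γ t : ℝ} (hΓ : 0 < Γ) (ht : 0 ≤ t) (n : ℕ) :
    |gammaAlternatingSum N Γ t n| ≤ 2 ^ n * (1 / Γ) := by
  refine abs_sum_choose_neg_one_pow_mul_le n fun m hm => ?_
  rw [Finset.mem_range] at hm
  rw [abs_of_nonneg (gammaDensity_nonneg hΓ ht), show N + n - m = (N + n - m - 1) + 1 by omega]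
  exact gammaDensity_succ_le _ hΓ ht

/-- Cauchy product of the series of e^{-b} with the Poisson-type series. A power series in b is
wanted because only the moments of the random b are computed. -/
lemma hasSum_ncGammaDensity {N : ℕ} (hN : 1 ≤ N) {Γ t : ℝ} (hΓ : 0 < Γ) (ht : 0 ≤ t) (b : ℝ) :
    HasSum (fun n : ℕ => b ^ n / n.factorial * gammaAlternatingSum N Γ t n)
      (ncGammaDensity N Γ b t) := by
  have hf : Summable fun m : ℕ => ‖(-b) ^ m / m.factorial‖ := by
    simp_rw [norm_div, norm_pow, RCLike.norm_natCast]
    exact Real.summable_pow_div_factorial _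
  have hg : Summable fun j : ℕ => ‖b ^ j / j.factorial * gammaDensity (N + j) Γ t‖ := by
    have := ((summable_ncGammaDensity hN hΓ b ht).mul_left (Real.exp b)).norm
    refine this.congr fun j => ?_
    rw [← mul_assoc, ← mul_assoc, ← Real.exp_add, add_neg_cancel, Real.exp_zero, one_mul]
  have hterm : ∀ n : ℕ, ∑ k ∈ Finset.range (n + 1), (-b) ^ k / k.factorial *
      (b ^ (n - k) / (n - k).factorial * gammaDensity (N + (n - k)) Γ t) =
      b ^ n / n.factorial * gammaAlternatingSum N Γ t n := by
    intro n
    unfold gammaAlternatingSum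
    rw [Finset.mul_sum]
    refine Finset.sum_congr rfl fun m hm => ?_
    have hm' : m ≤ n := by rw [Finset.mem_range] at hm; omega
    rw [show N + (n - m) = N + n - m by omega, Nat.cast_choose ℝ hm']
    have hb : b ^ n = b ^ m * b ^ (n - m) := by rw [← pow_add]; congr 1; omega
    have h1 : (n.factorial : ℝ) ≠ 0 := by positivity
    rw [neg_pow, hb]
    field_simp
  have hs := summable_norm_sum_mul_range_of_summable_norm hf hg
  have ht' := tsum_mul_tsum_eq_tsum_sum_range_of_summable_norm hf hg
  simp_rw [hterm] at hs ht'
  have hval : ncGammaDensity N Γ b t = ∑' n : ℕ, b ^ n / n.factorial * gammaAlternatingSum N Γ t n := by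
    rw [← ht']
    have he := (congrFun Real.exp_eq_exp_ℝ (-b)).trans
      (congrFun (NormedSpace.exp_eq_tsum_div (𝔸 := ℝ)) (-b))
    rw [← he, ← tsum_mul_left]
    unfold ncGammaDensity
    simp_rw [mul_assoc]
  rw [hval]
  exact hs.of_norm.hasSum

lemma ascPochhammer_eval_ratio_mem {N r : ℕ} (hN : 1 ≤ N) (hNr : N ≤ r) (n : ℕ) :
    0 ≤ (ascPochhammer ℝ n).eval (N : ℝ) / (ascPochhammer ℝ n).eval (r : ℝ) ∧
      (ascPochhammer ℝ n).eval (N : ℝ) / (ascPochhammer ℝ n).eval (r : ℝ) ≤ 1 := by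
  have hN0 : (0 : ℝ) < N := by exact_mod_cast hN
  have hr0 : (0 : ℝ) < r := by exact_mod_cast (by omega : 0 < r)
  have h1 := ascPochhammer_pos n (N : ℝ) hN0
  have h2 := ascPochhammer_pos n (r : ℝ) hr0
  refine ⟨by positivity, (div_le_one h2).mpr ?_⟩
  clear h1 h2
  induction n with
  | zero => simp
  | succ n ih =>
    rw [ascPochhammer_succ_eval, ascPochhammer_succ_eval]
    have := ascPochhammer_pos n (r : ℝ) hr0
    have hle : (N : ℝ) ≤ r := by exact_mod_cast hNr
    gcongr

lemma coeffA_nonneg {N r : ℕ} (hN : 1 ≤ N) (hNr : N ≤ r) (n : ℕ) {a : ℝ} (ha : 0 ≤ a) :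
    0 ≤ coeffA N r n a :=
  mul_nonneg (ascPochhammer_eval_ratio_mem hN hNr n).1 (by positivity)

lemma coeffA_le {N r : ℕ} (hN : 1 ≤ N) (hNr : N ≤ r) (n : ℕ) {a : ℝ} (ha : 0 ≤ a) :
    coeffA N r n a ≤ a ^ n / n.factorial :=
  mul_le_of_le_one_left (by positivity) (ascPochhammer_eval_ratio_mem hN hNr n).2

lemma summable_densityTerm {N r : ℕ} (hN : 1 ≤ N) (hNr : N ≤ r) {a Γ t : ℝ} (ha : 0 ≤ a)
    (hΓ : 0 < Γ) (ht : 0 ≤ t) : Summable (densityTerm N r a Γ t) := by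
  refine Summable.of_norm_bounded (g := fun n => (2 * a) ^ n / n.factorial * (1 / Γ))
    ((Real.summable_pow_div_factorial _).mul_right _) fun n => ?_
  rw [Real.norm_eq_abs, densityTerm, abs_mul, abs_of_nonneg (coeffA_nonneg hN hNr n ha)]
  calc coeffA N r n a * |gammaAlternatingSum N Γ t n|
      ≤ a ^ n / n.factorial * (2 ^ n * (1 / Γ)) :=
        mul_le_mul (coeffA_le hN hNr n ha) (abs_gammaAlternatingSum_le hN hΓ ht n)
          (abs_nonneg _) (by positivity)
    _ = (2 * a) ^ n / n.factorial * (1 / Γ) := by rw [mul_pow]; ring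

@[fun_prop]
lemma continuous_densityTerm (N r : ℕ) (a Γ : ℝ) (n : ℕ) :
    Continuous fun t => densityTerm N r a Γ t n := by
  unfold densityTerm; fun_prop

@[fun_prop]
lemma measurable_snrDensity (N r : ℕ) (a Γ : ℝ) : Measurable (snrDensity N r a Γ) := by
  unfold snrDensity
  exact Measurable.tsum fun n => (continuous_densityTerm N r a Γ n).measurable

/-- Termwise integration of the density series against a nonnegative weight whose integrals against
the gamma densities grow at most linearly in the shape. -/
lemma integral_mul_snrDensity {N r : ℕ} (hN : 1 ≤ N) (hNr : N ≤ r) {a Γ : ℝ} (ha : 0 ≤ a)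
    (hΓ : 0 < Γ) {φ : ℝ → ℝ} (hφm : Measurable φ) (hφ0 : ∀ t ∈ Set.Ioi (0 : ℝ), 0 ≤ φ t) {C : ℝ}
    (hφi : ∀ k, IntegrableOn (fun t => φ t * gammaDensity (k + 1) Γ t) (Set.Ioi 0))
    (hφC : ∀ k : ℕ, ∫ t in Set.Ioi 0, φ t * gammaDensity (k + 1) Γ t ≤ C * (k + 1)) :
    IntegrableOn (fun t => φ t * snrDensity N r a Γ t) (Set.Ioi 0) ∧
    HasSum (fun n => coeffA N r n a * ∑ m ∈ Finset.range (n + 1), (n.choose m : ℝ) * (-1) ^ m *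
        ∫ t in Set.Ioi 0, φ t * gammaDensity (N + n - m) Γ t)
      (∫ t in Set.Ioi 0, φ t * snrDensity N r a Γ t) := by
  have hshape : ∀ n m, m ∈ Finset.range (n + 1) → N + n - m = (N + n - m - 1) + 1 := by
    intro n m hm; rw [Finset.mem_range] at hm; omega
  have hint : ∀ n m, m ∈ Finset.range (n + 1) →
      Integrable (fun t => φ t * gammaDensity (N + n - m) Γ t) (volume.restrict (Set.Ioi 0)) := by
    intro n m hm; rw [hshape n m hm]; exact hφi _
  have hexp : ∀ n t, φ t * densityTerm N r a Γ t n = coeffA N r n a *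
      ∑ m ∈ Finset.range (n + 1), (n.choose m : ℝ) * (-1) ^ m *
        (φ t * gammaDensity (N + n - m) Γ t) := by
    intro n t
    unfold densityTerm
    rw [Finset.mul_sum, Finset.mul_sum, Finset.mul_sum]
    refine Finset.sum_congr rfl fun m _ => ?_
    ring
  have hFint : ∀ n, Integrable (fun t => φ t * densityTerm N r a Γ t n)
      (volume.restrict (Set.Ioi 0)) := by
    intro n
    simp_rw [hexp]
    exact (integrable_finsetSum _ fun m hm => (hint n m hm).const_mul _).const_mul _
  have hFval : ∀ n, ∫ t in Set.Ioi 0, φ t * densityTerm N r a Γ t n = coeffA N r n a *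
      ∑ m ∈ Finset.range (n + 1), (n.choose m : ℝ) * (-1) ^ m *
        ∫ t in Set.Ioi 0, φ t * gammaDensity (N + n - m) Γ t := by
    intro n
    simp_rw [hexp]
    rw [integral_const_mul, integral_finsetSum _ fun m hm => (hint n m hm).const_mul _]
    simp_rw [integral_const_mul]
  have hC0 : 0 ≤ C := by
    have h1 := hφC 0
    have h2 : 0 ≤ ∫ t in Set.Ioi 0, φ t * gammaDensity (0 + 1) Γ t :=
      setIntegral_nonneg measurableSet_Ioi fun t ht =>
        mul_nonneg (hφ0 t ht) (gammaDensity_nonneg hΓ (le_of_lt ht))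
    simp only [CharP.cast_eq_zero, zero_add, mul_one] at h1 h2
    linarith
  -- The 4 is 2 · 2: one 2ⁿ is the sum of the binomial coefficients, the other comes from N + n ≤ (N
  -- + 1)2ⁿ, absorbing the linear growth in the shape.
  have hbound : ∀ n : ℕ, ∫ t in Set.Ioi 0, ‖φ t * densityTerm N r a Γ t n‖ ≤
      (4 * a) ^ n / n.factorial * (C * (N + 1)) := by
    intro n
    have h1 : ∀ t ∈ Set.Ioi (0 : ℝ), ‖φ t * densityTerm N r a Γ t n‖ ≤ coeffA N r n a *
        ∑ m ∈ Finset.range (n + 1), (n.choose m : ℝ) * (φ t * gammaDensity (N + n - m) Γ t) := by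
      intro t ht
      rw [hexp, norm_mul, Real.norm_of_nonneg (coeffA_nonneg hN hNr n ha)]
      refine mul_le_mul_of_nonneg_left ((norm_sum_le _ _).trans (Finset.sum_le_sum fun m _ => ?_))
        (coeffA_nonneg hN hNr n ha)
      rw [norm_mul, norm_mul, norm_pow, norm_neg, norm_one, one_pow, mul_one,
        Real.norm_of_nonneg (Nat.cast_nonneg _), Real.norm_of_nonneg
        (mul_nonneg (hφ0 t ht) (gammaDensity_nonneg hΓ (le_of_lt ht)))]
    have h2 : Integrable (fun t => coeffA N r n a * ∑ m ∈ Finset.range (n + 1),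
        (n.choose m : ℝ) * (φ t * gammaDensity (N + n - m) Γ t)) (volume.restrict (Set.Ioi 0)) :=
      (integrable_finsetSum _ fun m hm => (hint n m hm).const_mul _).const_mul _
    refine (setIntegral_mono_on (hFint n).norm h2 measurableSet_Ioi h1).trans ?_
    rw [integral_const_mul, integral_finsetSum _ fun m hm => (hint n m hm).const_mul _]
    simp_rw [integral_const_mul]
    have h3 : ∑ m ∈ Finset.range (n + 1), (n.choose m : ℝ) *
        ∫ t in Set.Ioi 0, φ t * gammaDensity (N + n - m) Γ t ≤
        ∑ m ∈ Finset.range (n + 1), (n.choose m : ℝ) * (C * (N + n)) := by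
      refine Finset.sum_le_sum fun m hm => mul_le_mul_of_nonneg_left ?_ (Nat.cast_nonneg _)
      have h4 := hφC (N + n - m - 1)
      rw [← hshape n m hm] at h4
      refine h4.trans (mul_le_mul_of_nonneg_left ?_ hC0)
      have h5 : N + n - m - 1 + 1 ≤ N + n := by omega
      exact_mod_cast h5
    rw [← Finset.sum_mul] at h3
    have h6 : ∑ m ∈ Finset.range (n + 1), (n.choose m : ℝ) = 2 ^ n := by
      exact_mod_cast Nat.sum_range_choose n
    rw [h6] at h3
    have h7 : ((N : ℝ) + n) ≤ (N + 1) * 2 ^ n := by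
      have hn : (n : ℝ) + 1 ≤ 2 ^ n := by exact_mod_cast Nat.lt_two_pow_self (n := n)
      have hn1 : (1 : ℝ) ≤ 2 ^ n := one_le_pow₀ (by norm_num)
      have : (0 : ℝ) ≤ N := Nat.cast_nonneg _
      nlinarith
    calc _ ≤ a ^ n / n.factorial * (2 ^ n * (C * (N + n))) :=
          mul_le_mul (coeffA_le hN hNr n ha) h3
            (Finset.sum_nonneg fun m _ => mul_nonneg (Nat.cast_nonneg _)
              (setIntegral_nonneg measurableSet_Ioi fun t ht =>
                mul_nonneg (hφ0 t ht) (gammaDensity_nonneg hΓ (le_of_lt ht)))) (by positivity)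
      _ ≤ a ^ n / n.factorial * (2 ^ n * (C * ((N + 1) * 2 ^ n))) := by gcongr
      _ = (4 * a) ^ n / n.factorial * (C * (N + 1)) := by
          rw [mul_pow, show (4 : ℝ) = 2 * 2 by norm_num, mul_pow]; ring
  have hsum : Summable fun n => ∫ t in Set.Ioi 0, ‖φ t * densityTerm N r a Γ t n‖ :=
    Summable.of_nonneg_of_le (fun n => integral_nonneg fun t => norm_nonneg _) hbound
      ((Real.summable_pow_div_factorial _).mul_right _)
  have htsum : ∀ t, ∑' n, φ t * densityTerm N r a Γ t n = φ t * snrDensity N r a Γ t := by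
    intro t; rw [tsum_mul_left]; rfl
  constructor
  · refine ⟨(hφm.mul (measurable_snrDensity N r a Γ)).aestronglyMeasurable, ?_⟩
    have h1 : ∫⁻ t in Set.Ioi 0, ∑' n, ‖φ t * densityTerm N r a Γ t n‖ₑ =
        ∑' n, ENNReal.ofReal (∫ t in Set.Ioi 0, ‖φ t * densityTerm N r a Γ t n‖) := by
      rw [lintegral_tsum fun n => (hFint n).1.enorm]
      exact tsum_congr fun n => (ofReal_integral_norm_eq_lintegral_enorm (hFint n)).symm
    have h2 : ∫⁻ t in Set.Ioi 0, ∑' n, ‖φ t * densityTerm N r a Γ t n‖ₑ < ⊤ := by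
      rw [h1]
      exact hsum.tsum_ofReal_lt_top
    refine lt_of_le_of_lt (setLIntegral_mono' measurableSet_Ioi fun t ht => ?_) h2
    beta_reduce
    rw [← htsum]
    exact enorm_tsum_le_tsum_enorm
  · have h := hasSum_integral_of_summable_integral_norm hFint hsum
    simp_rw [hFval, htsum] at h
    exact h

/-! ### The law of the squared distance to a random subspace -/

lemma ncGammaDensity_le {N : ℕ} (hN : 1 ≤ N) {Γ b t : ℝ} (hΓ : 0 < Γ) (hb : 0 ≤ b) (ht : 0 ≤ t) :
    ncGammaDensity N Γ b t ≤ 1 / Γ := by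
  have he := (congrFun Real.exp_eq_exp_ℝ b).trans
    (congrFun (NormedSpace.exp_eq_tsum_div (𝔸 := ℝ)) b)
  calc ncGammaDensity N Γ b t
      ≤ ∑' j : ℕ, Real.exp (-b) * (b ^ j / j.factorial) * (1 / Γ) := by
        refine (summable_ncGammaDensity hN hΓ b ht).tsum_le_tsum (fun j => ?_)
          (((Real.summable_pow_div_factorial _).mul_left _).mul_right _)
        refine mul_le_mul_of_nonneg_left ?_ (by positivity)
        rw [show N + j = (N + j - 1) + 1 by omega]
        exact gammaDensity_succ_le _ hΓ ht
    _ = 1 / Γ := by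
        rw [tsum_mul_right, tsum_mul_left, ← he, ← Real.exp_add, neg_add_cancel, Real.exp_zero,
          one_mul]

section

variable {k r : ℕ} (m : EuclideanSpace ℂ (Fin r))

lemma ae_residualSq_mem (hk : k < r) :
    ∀ᵐ z ∂(Measure.pi fun _ : Fin k => stdGaussian (EuclideanSpace ℂ (Fin r))),
      0 ≤ residualSq m z / 2 ∧ residualSq m z / 2 ≤ ‖m‖ ^ 2 / 2 := by
  filter_upwards [ae_linearIndependent_stdGaussian k hk.le] with z hz
  rw [residualSq_eq hz]
  have h := (orthSpan z).norm_starProjection_apply_le m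
  refine ⟨by positivity, by gcongr⟩

lemma measurable_residualSq_right :
    Measurable fun z : Fin k → EuclideanSpace ℂ (Fin r) => residualSq m z := by
  have h := (measurable_residualSq (k := k) (r := r)).comp (measurable_prodMk_left (x := m))
  exact h

lemma integral_residualSq_pow (hk : k < r) (n : ℕ) :
    Integrable (fun z => (residualSq m z / 2) ^ n)
      (Measure.pi fun _ : Fin k => stdGaussian (EuclideanSpace ℂ (Fin r))) ∧
    ∫ z, (residualSq m z / 2) ^ n
      ∂(Measure.pi fun _ : Fin k => stdGaussian (EuclideanSpace ℂ (Fin r))) =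
    (ascPochhammer ℝ n).eval ((r - k : ℕ) : ℝ) / (ascPochhammer ℝ n).eval (r : ℝ) *
      (‖m‖ ^ 2 / 2) ^ n := by
  have h0 : 0 ≤ᵐ[Measure.pi fun _ : Fin k => stdGaussian (EuclideanSpace ℂ (Fin r))]
      fun z => (residualSq m z / 2) ^ n := by
    filter_upwards [ae_residualSq_mem m hk] with z hz using pow_nonneg hz.1 n
  have hm : AEStronglyMeasurable (fun z => (residualSq m z / 2) ^ n)
      (Measure.pi fun _ : Fin k => stdGaussian (EuclideanSpace ℂ (Fin r))) :=
    (((measurable_residualSq_right m).div_const 2).pow_const n).aestronglyMeasurable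
  have hl := lintegral_residualSq_pow hk n m
  refine ⟨⟨hm, ?_⟩, ?_⟩
  · rw [hasFiniteIntegral_iff_ofReal h0, hl]
    exact ENNReal.ofReal_lt_top
  · rw [integral_eq_lintegral_of_nonneg_ae h0 hm, hl, ENNReal.toReal_ofReal]
    exact mul_nonneg (ascPochhammer_eval_ratio_mem (by omega) (by omega) n).1 (by positivity)

lemma measurable_ncGammaDensity_residualSq (N : ℕ) (Γ : ℝ) :
    Measurable fun p : ℝ × (Fin k → EuclideanSpace ℂ (Fin r)) =>
      ncGammaDensity N Γ (residualSq m p.2 / 2) p.1 :=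
  (measurable_ncGammaDensity N Γ).comp
    ((((measurable_residualSq_right m).comp measurable_snd).div_const 2).prodMk measurable_fst)

/-- Averaging the power series in b replaces bⁿ by its moment. The interchange is legitimate because
a projection shortens vectors: 0 ≤ b ≤ ‖m‖²/2 almost surely. -/
lemma integral_ncGammaDensity_residualSq (hk : k < r) {Γ t : ℝ} (hΓ : 0 < Γ) (ht : 0 ≤ t) :
    ∫ z, ncGammaDensity (r - k) Γ (residualSq m z / 2) t
      ∂(Measure.pi fun _ : Fin k => stdGaussian (EuclideanSpace ℂ (Fin r))) =
      snrDensity (r - k) r (‖m‖ ^ 2 / 2) Γ t := by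
  set π := Measure.pi fun _ : Fin k => stdGaussian (EuclideanSpace ℂ (Fin r))
  have hN : 1 ≤ r - k := by omega
  set G := fun (n : ℕ) (z : Fin k → EuclideanSpace ℂ (Fin r)) =>
    (residualSq m z / 2) ^ n / n.factorial * gammaAlternatingSum (r - k) Γ t n with hG
  have hGi : ∀ n, Integrable (G n) π := fun n =>
    ((integral_residualSq_pow m hk n).1.div_const _).mul_const _
  have hGv : ∀ n, ∫ z, G n z ∂π = densityTerm (r - k) r (‖m‖ ^ 2 / 2) Γ t n := by
    intro n
    simp only [hG]
    rw [integral_mul_const, integral_div, (integral_residualSq_pow m hk n).2, densityTerm, coeffA,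
      gammaAlternatingSum]
    ring
  have hbd : ∀ n, ∫ z, ‖G n z‖ ∂π ≤ (2 * (‖m‖ ^ 2 / 2)) ^ n / n.factorial * (1 / Γ) := by
    intro n
    have h1 : ∀ᵐ z ∂π, ‖G n z‖ ≤ (2 * (‖m‖ ^ 2 / 2)) ^ n / n.factorial * (1 / Γ) := by
      filter_upwards [ae_residualSq_mem m hk] with z hz
      simp only [hG]
      rw [norm_mul, Real.norm_of_nonneg (div_nonneg (pow_nonneg hz.1 n) (Nat.cast_nonneg _)),
        Real.norm_eq_abs]
      calc _ ≤ (‖m‖ ^ 2 / 2) ^ n / n.factorial * (2 ^ n * (1 / Γ)) := by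
            refine mul_le_mul ?_ (abs_gammaAlternatingSum_le hN hΓ ht n) (abs_nonneg _)
              (by positivity)
            have := pow_le_pow_left₀ hz.1 hz.2 n
            gcongr
        _ = _ := by rw [mul_pow]; ring
    have := integral_mono_ae (hGi n).norm (integrable_const _) h1
    simpa using this
  have hsum : Summable fun n => ∫ z, ‖G n z‖ ∂π :=
    Summable.of_nonneg_of_le (fun n => integral_nonneg fun z => norm_nonneg _) hbd
      ((Real.summable_pow_div_factorial _).mul_right _)
  have h := (hasSum_integral_of_summable_integral_norm hGi hsum).tsum_eq
  simp_rw [hGv] at h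
  rw [snrDensity, h]
  refine integral_congr_ae (Filter.Eventually.of_forall fun z => ?_)
  exact (hasSum_ncGammaDensity hN hΓ ht _).tsum_eq.symm

/-- The series alternates in sign, so nonnegativity is read off from its representation as a mean of
noncentral gamma densities. -/
lemma snrDensity_nonneg (hk : k < r) {Γ t : ℝ} (hΓ : 0 < Γ) (ht : 0 ≤ t) :
    0 ≤ snrDensity (r - k) r (‖m‖ ^ 2 / 2) Γ t := by
  rw [← integral_ncGammaDensity_residualSq m hk hΓ ht]
  refine integral_nonneg_of_ae ?_
  filter_upwards [ae_residualSq_mem m hk] with z hz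
  exact ncGammaDensity_nonneg _ hΓ hz.1 ht

lemma lintegral_ncGammaDensity_residualSq (hk : k < r) {Γ t : ℝ} (hΓ : 0 < Γ) (ht : 0 ≤ t) :
    ∫⁻ z, ENNReal.ofReal (ncGammaDensity (r - k) Γ (residualSq m z / 2) t)
      ∂(Measure.pi fun _ : Fin k => stdGaussian (EuclideanSpace ℂ (Fin r))) =
      ENNReal.ofReal (snrDensity (r - k) r (‖m‖ ^ 2 / 2) Γ t) := by
  rw [← integral_ncGammaDensity_residualSq m hk hΓ ht, ofReal_integral_eq_lintegral_ofReal]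
  · refine Integrable.of_bound (C := 1 / Γ)
      ((measurable_ncGammaDensity_residualSq m (r - k) Γ).comp
        (measurable_prodMk_left (x := t))).aestronglyMeasurable ?_
    filter_upwards [ae_residualSq_mem m hk] with z hz
    rw [Real.norm_of_nonneg (ncGammaDensity_nonneg _ hΓ hz.1 ht)]
    exact ncGammaDensity_le (by omega) hΓ hz.1 ht
  · filter_upwards [ae_residualSq_mem m hk] with z hz
    exact ncGammaDensity_nonneg _ hΓ hz.1 ht

theorem map_residualSq_stdGaussian (hk : k < r) {Γ : ℝ} (hΓ : 0 < Γ) :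
    ((stdGaussian (EuclideanSpace ℂ (Fin r))).prod
      (Measure.pi fun _ : Fin k => stdGaussian (EuclideanSpace ℂ (Fin r)))).map
        (fun p => Γ * (residualSq (m + p.1) p.2 / 2)) =
      (volume.restrict (Set.Ici 0)).withDensity
        (fun t => ENNReal.ofReal (snrDensity (r - k) r (‖m‖ ^ 2 / 2) Γ t)) := by
  set π := Measure.pi fun _ : Fin k => stdGaussian (EuclideanSpace ℂ (Fin r))
  have hmeas : Measurable fun p : EuclideanSpace ℂ (Fin r) × (Fin k → EuclideanSpace ℂ (Fin r)) =>
      Γ * (residualSq (m + p.1) p.2 / 2) :=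
    ((measurable_residualSq.comp ((measurable_fst.const_add m).prodMk measurable_snd)).div_const
      2).const_mul Γ
  ext s hs
  -- Slicing at fixed z: each slice carries a noncentral gamma law, and Tonelli then averages the
  -- density over z.
  rw [Measure.map_apply hmeas hs, Measure.prod_apply_symm (hmeas hs), withDensity_apply _ hs]
  have h1 : ∀ᵐ z ∂π, (stdGaussian (EuclideanSpace ℂ (Fin r)))
      ((fun g => (g, z)) ⁻¹' ((fun p : EuclideanSpace ℂ (Fin r) ×
        (Fin k → EuclideanSpace ℂ (Fin r)) => Γ * (residualSq (m + p.1) p.2 / 2)) ⁻¹' s)) =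
      ∫⁻ t in s, ENNReal.ofReal (ncGammaDensity (r - k) Γ (residualSq m z / 2) t)
        ∂(volume.restrict (Set.Ici 0)) := by
    filter_upwards [ae_linearIndependent_stdGaussian k hk.le] with z hz
    have h2 := map_normSq_starProjection_stdGaussian (N := r - k) (by omega) (finrank_orthSpan hz) m hΓ
    rw [residualSq_eq hz, ← withDensity_apply _ hs, ← h2, Measure.map_apply (by fun_prop) hs]
    congr 1
    ext g
    simp only [Set.mem_preimage, residualSq_eq hz]
  rw [lintegral_congr_ae h1, lintegral_lintegral_swap]
  · rw [Measure.restrict_restrict hs]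
    refine setLIntegral_congr_fun (hs.inter measurableSet_Ici) fun t ht => ?_
    exact lintegral_ncGammaDensity_residualSq m hk hΓ ht.2
  · exact ((measurable_ncGammaDensity_residualSq m (r - k) Γ).comp
      measurable_swap).ennreal_ofReal.aemeasurable

end

/-! ### Evaluation of the capacity integrals -/

lemma log_one_add_mul_le {x : ℝ} (hx : 0 ≤ x) : Real.log (1 + x) ≤ x := by
  have := Real.log_le_sub_one_of_pos (by positivity : 0 < 1 + x)
  linarith

lemma log_one_add_nonneg {x : ℝ} (hx : 0 ≤ x) : 0 ≤ Real.log (1 + x) :=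
  Real.log_nonneg (by linarith)

lemma integrableOn_log_mul_pow_mul_exp (Q : ℕ) {Γ r : ℝ} (hΓ : 0 < Γ) (hr : 0 < r) :
    IntegrableOn (fun y => Real.log (1 + Γ * y) * y ^ Q * Real.exp (-(r * y))) (Set.Ioi 0) := by
  have hm : Measurable fun y => Real.log (1 + Γ * y) * y ^ Q * Real.exp (-(r * y)) :=
    ((Real.measurable_log.comp (by fun_prop)).mul (by fun_prop)).mul (by fun_prop)
  refine Integrable.mono' ((integrableOn_pow_mul_exp_neg_mul (Q + 1) hr).const_mul Γ)
    hm.aestronglyMeasurable ?_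
  filter_upwards [ae_restrict_mem measurableSet_Ioi] with y hy
  have hy0 : (0 : ℝ) < y := hy
  have hx : 0 ≤ Γ * y := by positivity
  have := log_one_add_nonneg hx
  rw [Real.norm_of_nonneg (by positivity)]
  calc Real.log (1 + Γ * y) * y ^ Q * Real.exp (-(r * y))
      ≤ (Γ * y) * y ^ Q * Real.exp (-(r * y)) := by gcongr; exact log_one_add_mul_le hx
    _ = Γ * (y ^ (Q + 1) * Real.exp (-(r * y))) := by ring

lemma capC_eq_integral_log_one_add_mul (Q : ℕ) {Γ : ℝ} (hΓ : 0 < Γ) :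
    capC Q Γ = 1 / (Q.factorial : ℝ) *
      ∫ y in Set.Ioi (0 : ℝ), Real.log (1 + Γ * y) * y ^ Q * Real.exp (-y) := by
  have h := integral_comp_mul_left_Ioi'
    (fun t => Real.log (1 + t) * t ^ Q * Real.exp (-t / Γ)) 0 hΓ
  rw [mul_zero] at h
  unfold capC
  rw [← h, smul_eq_mul, mul_assoc]
  congr 1
  have h2 : ∀ y, Real.log (1 + Γ * y) * (Γ * y) ^ Q * Real.exp (-(Γ * y) / Γ) =
      Γ ^ Q * (Real.log (1 + Γ * y) * y ^ Q * Real.exp (-y)) := by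
    intro y
    rw [mul_pow, show -(Γ * y) / Γ = -y by field_simp]
    ring
  simp_rw [h2]
  rw [integral_const_mul, pow_succ]
  field_simp

/-- The integrals `∫₀^∞ y^q / (y + c) e^{-y} dy`. -/
noncomputable def stieltjesExp (q : ℕ) (c : ℝ) : ℝ :=
  ∫ y in Set.Ioi (0 : ℝ), y ^ q * Real.exp (-y) / (y + c)

lemma integrableOn_stieltjesExp (q : ℕ) {c : ℝ} (hc : 0 < c) :
    IntegrableOn (fun y => y ^ q * Real.exp (-y) / (y + c)) (Set.Ioi 0) := by
  have hm : Measurable fun y : ℝ => y ^ q * Real.exp (-y) / (y + c) := by fun_prop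
  refine Integrable.mono' ((integrableOn_pow_mul_exp_neg_mul q one_pos).div_const c)
    hm.aestronglyMeasurable ?_
  filter_upwards [ae_restrict_mem measurableSet_Ioi] with y hy
  have hy0 : (0 : ℝ) < y := hy
  rw [Real.norm_of_nonneg (by positivity), one_mul]
  gcongr
  linarith

lemma stieltjesExp_zero (c : ℝ) : stieltjesExp 0 c = Real.exp c * expIntegralE₁ c := by
  unfold stieltjesExp expIntegralE₁
  have h := (measurePreserving_add_right volume c).setIntegral_preimage_emb
    (measurableEmbedding_addRight c) (fun t => t⁻¹ * Real.exp (-t)) (Set.Ioi c)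
  rw [Set.preimage_add_const_Ioi, sub_self] at h
  rw [← h, ← integral_const_mul]
  refine integral_congr_ae (Filter.Eventually.of_forall fun y => ?_)
  simp only [pow_zero, one_mul]
  rw [neg_add, Real.exp_add, Real.exp_neg c]
  field_simp

/-- Polynomial division: y^{q+1}/(y + c) = y^q - c y^q/(y + c). -/
lemma stieltjesExp_succ (q : ℕ) {c : ℝ} (hc : 0 < c) :
    stieltjesExp (q + 1) c = q.factorial - c * stieltjesExp q c := by
  have h1 := integral_pow_mul_exp_neg_mul q one_pos
  have h2 := integrableOn_pow_mul_exp_neg_mul q one_pos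
  simp only [one_mul, one_pow, div_one] at h1 h2
  unfold stieltjesExp
  rw [← h1, ← integral_const_mul, ← integral_sub h2 ((integrableOn_stieltjesExp q hc).const_mul c)]
  refine setIntegral_congr_fun measurableSet_Ioi fun y hy => ?_
  have hy0 : (0 : ℝ) < y := hy
  have : y + c ≠ 0 := by positivity
  field_simp
  ring

lemma stieltjesExp_eq (q : ℕ) {c : ℝ} (hc : 0 < c) :
    stieltjesExp q c = (-c) ^ q * (Real.exp c * expIntegralE₁ c) +
      ∑ i ∈ Finset.range q, (-c) ^ i * ((q - i - 1).factorial : ℝ) := by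
  induction q with
  | zero => simp [stieltjesExp_zero]
  | succ q ih =>
    rw [stieltjesExp_succ q hc, ih, Finset.sum_range_succ', mul_add, Finset.mul_sum]
    have : ∀ i ∈ Finset.range q, c * ((-c) ^ i * ((q - i - 1).factorial : ℝ)) =
        -((-c) ^ (i + 1) * ((q + 1 - (i + 1) - 1).factorial : ℝ)) := by
      intro i _
      rw [Nat.add_sub_add_right]
      ring
    rw [Finset.sum_congr rfl this, Finset.sum_neg_distrib]
    simp only [pow_zero, one_mul, Nat.sub_zero, Nat.add_sub_cancel]
    ring

lemma tendsto_log_mul_pow_mul_exp (Q : ℕ) {Γ : ℝ} (hΓ : 0 < Γ) :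
    Filter.Tendsto (fun y => Real.log (1 + Γ * y) * (y ^ Q * Real.exp (-y))) Filter.atTop
      (nhds 0) := by
  have h := (Real.tendsto_pow_mul_exp_neg_atTop_nhds_zero (Q + 1)).const_mul Γ
  rw [mul_zero] at h
  refine squeeze_zero' ?_ ?_ h
  · filter_upwards [Filter.eventually_ge_atTop 0] with y hy
    have := log_one_add_nonneg (by positivity : 0 ≤ Γ * y)
    positivity
  · filter_upwards [Filter.eventually_ge_atTop 0] with y hy
    calc Real.log (1 + Γ * y) * (y ^ Q * Real.exp (-y))
        ≤ (Γ * y) * (y ^ Q * Real.exp (-y)) := by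
          gcongr; exact log_one_add_mul_le (by positivity)
      _ = Γ * (y ^ (Q + 1) * Real.exp (-y)) := by ring

lemma hasDerivAt_log_one_add_mul {Γ y : ℝ} (hΓ : 0 < Γ) (hy : 0 ≤ y) :
    HasDerivAt (fun y => Real.log (1 + Γ * y)) (1 / (y + 1 / Γ)) y := by
  have h : HasDerivAt (fun y => Real.log (1 + Γ * y)) (Γ * 1 / (1 + Γ * y)) y :=
    (((hasDerivAt_id y).const_mul Γ).const_add 1).log (by simp only [id]; positivity)
  convert h using 1
  have : 1 + Γ * y ≠ 0 := by positivity
  have : y * Γ + 1 ≠ 0 := by positivity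
  field_simp
  ring

lemma capC_zero {Γ : ℝ} (hΓ : 0 < Γ) : capC 0 Γ = stieltjesExp 0 (1 / Γ) := by
  have hc : 0 < 1 / Γ := by positivity
  have hi1 := integrableOn_log_mul_pow_mul_exp 0 hΓ one_pos
  have hi2 := integrableOn_stieltjesExp 0 hc
  simp only [one_mul] at hi1
  have hderiv : ∀ y ∈ Set.Ici (0 : ℝ), HasDerivAt
      (fun y => Real.log (1 + Γ * y) * (y ^ 0 * Real.exp (-y)))
      (y ^ 0 * Real.exp (-y) / (y + 1 / Γ) - Real.log (1 + Γ * y) * y ^ 0 * Real.exp (-y)) y := by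
    intro y hy
    have h := (hasDerivAt_log_one_add_mul hΓ hy).mul
      ((hasDerivAt_pow 0 y).mul ((hasDerivAt_neg y).exp))
    refine h.congr_deriv ?_
    simp only [Pi.mul_apply, pow_zero, CharP.cast_eq_zero, zero_mul]
    ring
  have h := integral_Ioi_of_hasDerivAt_of_tendsto' hderiv (hi2.sub hi1)
    (tendsto_log_mul_pow_mul_exp 0 hΓ)
  rw [integral_sub hi2 hi1] at h
  simp only [mul_zero, add_zero, Real.log_one, zero_mul, sub_zero] at h
  rw [capC_eq_integral_log_one_add_mul 0 hΓ, Nat.factorial_zero, Nat.cast_one, div_one, one_mul,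
    stieltjesExp]
  linarith

/-- Integration by parts: log(1 + Γy) y^{Q+1} e^{-y} vanishes at 0 and at infinity, so its
derivative integrates to 0. The derivative of the logarithm is 1/(y + 1/Γ), which produces the extra
integral. -/
lemma capC_succ (Q : ℕ) {Γ : ℝ} (hΓ : 0 < Γ) :
    capC (Q + 1) Γ = capC Q Γ + 1 / ((Q + 1).factorial : ℝ) * stieltjesExp (Q + 1) (1 / Γ) := by
  have hc : 0 < 1 / Γ := by positivity
  have hi1 := integrableOn_log_mul_pow_mul_exp (Q + 1) hΓ one_pos
  have hi0 := (integrableOn_log_mul_pow_mul_exp Q hΓ one_pos).const_mul ((Q : ℝ) + 1)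
  have hi2 := integrableOn_stieltjesExp (Q + 1) hc
  simp only [one_mul] at hi1 hi0
  have hderiv : ∀ y ∈ Set.Ici (0 : ℝ), HasDerivAt
      (fun y => Real.log (1 + Γ * y) * (y ^ (Q + 1) * Real.exp (-y)))
      (y ^ (Q + 1) * Real.exp (-y) / (y + 1 / Γ) -
        (Real.log (1 + Γ * y) * y ^ (Q + 1) * Real.exp (-y) -
          ((Q : ℝ) + 1) * (Real.log (1 + Γ * y) * y ^ Q * Real.exp (-y)))) y := by
    intro y hy
    have h := (hasDerivAt_log_one_add_mul hΓ hy).mul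
      ((hasDerivAt_pow (Q + 1) y).mul ((hasDerivAt_neg y).exp))
    refine h.congr_deriv ?_
    simp only [Pi.mul_apply, Nat.add_sub_cancel, Nat.cast_add, Nat.cast_one]
    ring
  have h := integral_Ioi_of_hasDerivAt_of_tendsto' hderiv (hi2.sub (hi1.sub hi0))
    (tendsto_log_mul_pow_mul_exp (Q + 1) hΓ)
  have hs1 := integral_sub hi2 (hi1.sub hi0)
  have hs2 := integral_sub hi1 hi0
  simp only [Pi.sub_apply] at hs1
  rw [hs1, hs2, integral_const_mul] at h
  simp only [mul_zero, add_zero, Real.log_one, zero_mul, sub_zero] at h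
  rw [capC_eq_integral_log_one_add_mul Q hΓ, capC_eq_integral_log_one_add_mul (Q + 1) hΓ,
    stieltjesExp, Nat.factorial_succ]
  push_cast
  generalize (∫ y in Set.Ioi (0 : ℝ), y ^ (Q + 1) * Real.exp (-y) / (y + 1 / Γ)) = T at h ⊢
  have h1 : (Q.factorial : ℝ) ≠ 0 := by positivity
  have h2 : (Q : ℝ) + 1 ≠ 0 := by positivity
  field_simp
  linarith

theorem capC_eq (Q : ℕ) {Γ : ℝ} (hΓ : 0 < Γ) :
    capC Q Γ = Real.exp (1 / Γ) * expIntegralE₁ (1 / Γ) +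
      ∑ q₁ ∈ Finset.Icc 1 Q, 1 / (q₁.factorial : ℝ) *
        ((-1 / Γ) ^ q₁ * (Real.exp (1 / Γ) * expIntegralE₁ (1 / Γ)) +
          ∑ q₂ ∈ Finset.range q₁, (-1 / Γ) ^ q₂ * ((q₁ - q₂ - 1).factorial : ℝ)) := by
  induction Q with
  | zero => simp [capC_zero hΓ, stieltjesExp_zero]
  | succ Q ih =>
    rw [capC_succ Q hΓ, ih, Finset.sum_Icc_succ_top (by omega), add_assoc,
      stieltjesExp_eq (Q + 1) (by positivity : 0 < 1 / Γ), neg_div]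

/-! ### The zero-forcing SNR as a squared distance -/

/-- The first column of the specular part of the channel, normalized by the whitening. -/
noncomputable def specularMean {NR k : ℕ} (K ρ : ℝ) (Hdn : Matrix (Fin NR) (Fin (k + 1)) ℂ) :
    EuclideanSpace ℂ (Fin NR) :=
  WithLp.toLp 2 fun i => ((√(2 * K * ρ) : ℝ) : ℂ) * Hdn i 0

lemma norm_sq_specularMean {NR k : ℕ} {K ρ : ℝ} (hK : 0 ≤ K) (hρ : 0 ≤ ρ)
    {Hdn : Matrix (Fin NR) (Fin (k + 1)) ℂ} (h0 : ∀ i j, j ≠ 0 → Hdn i j = 0) :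
    ‖specularMean K ρ Hdn‖ ^ 2 = 2 * K * ρ * ∑ i, ∑ j, ‖Hdn i j‖ ^ 2 := by
  rw [EuclideanSpace.norm_sq_eq, Finset.mul_sum]
  refine Finset.sum_congr rfl fun i _ => ?_
  rw [Finset.sum_eq_single 0 (fun j _ hj => by simp [h0 i j hj]) (by simp)]
  simp only [specularMean]
  rw [norm_mul, mul_pow, Complex.norm_real, Real.norm_eq_abs, sq_abs, Real.sq_sqrt (by positivity)]

/-- With s = √(2(K+1)) and C = H(sM), one has (HᴴH)⁻¹ = (sM)(CᴴC)⁻¹(sM)ᴴ. Only the first entry of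
row 0 of M is nonzero, so the (0,0) entries differ by the factor 2(K+1)ρ. -/
lemma zfSNR_ricianChannel_eq {Ω : Type*} {NR k : ℕ} {K Γs : ℝ} (hK : 0 ≤ K)
    {R M : Matrix (Fin (k + 1)) (Fin (k + 1)) ℂ} (hρ : 0 < (R⁻¹ 0 0).re) (hM : Mᴴ * R * M = 1)
    (hM0 : ∀ j, M 0 j = if j = 0 then ((√(R⁻¹ 0 0).re : ℝ) : ℂ) else 0)
    {Hdn : Matrix (Fin NR) (Fin (k + 1)) ℂ} (h0 : ∀ i j, j ≠ 0 → Hdn i j = 0)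
    (Hrn : Ω → Matrix (Fin NR) (Fin (k + 1)) ℂ) (ω : Ω) :
    zfSNR Γs (ricianChannel K Hdn Hrn ω) = scaleΓ₁ Γs K R *
      (residualSq (specularMean K (R⁻¹ 0 0).re Hdn + whitenedColumns M (Hrn ω) 0)
        (fun j => whitenedColumns M (Hrn ω) j.succ) / 2) := by
  set ρ := (R⁻¹ 0 0).re with hρdef
  have hK1 : 0 < K + 1 := by linarith
  set s : ℂ := ((√(2 * (K + 1)) : ℝ) : ℂ) with hs
  have hs2 : s * s = ((2 * (K + 1) : ℝ) : ℂ) := by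
    rw [hs, ← Complex.ofReal_mul, Real.mul_self_sqrt (by positivity)]
  have hs0 : s ≠ 0 := by
    rw [hs]; exact_mod_cast (Real.sqrt_pos.mpr (by positivity : 0 < 2 * (K + 1))).ne'
  set H := ricianChannel K Hdn Hrn ω with hH
  set c : Fin (k + 1) → EuclideanSpace ℂ (Fin NR) :=
    Fin.cons (specularMean K ρ Hdn + whitenedColumns M (Hrn ω) 0)
      (fun j => whitenedColumns M (Hrn ω) j.succ) with hc
  have hcol : columnsMatrix c = H * (s • M) := by
    have e1 : √(2 * (K + 1)) * √(1 / (K + 1)) = √2 := by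
      rw [← Real.sqrt_mul (by positivity)]
      congr 1; field_simp
    have e2 : √(2 * (K + 1)) * √(K / (K + 1)) * √ρ = √(2 * K * ρ) := by
      rw [← Real.sqrt_mul (by positivity), ← Real.sqrt_mul (by positivity)]
      congr 1; field_simp
    have e1' : s * ((√(1 / (K + 1)) : ℝ) : ℂ) = ((√2 : ℝ) : ℂ) := by
      rw [hs, ← Complex.ofReal_mul, e1]
    have e2' : s * ((√(K / (K + 1)) : ℝ) : ℂ) * ((√ρ : ℝ) : ℂ) = ((√(2 * K * ρ) : ℝ) : ℂ) := by
      rw [hs, ← Complex.ofReal_mul, ← Complex.ofReal_mul, e2]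
    -- The Rician–Rayleigh hypothesis enters here: with the first row of M supported at column 0,
    -- the mean survives in that column only.
    have hd : ∀ i j, (Hdn * M) i j = Hdn i 0 * M 0 j := by
      intro i j
      rw [Matrix.mul_apply]
      exact Finset.sum_eq_single 0 (fun l _ hl => by rw [h0 i l hl, zero_mul]) (by simp)
    have hprod : H * (s • M) = (s * ((√(K / (K + 1)) : ℝ) : ℂ)) • (Hdn * M) +
        ((√2 : ℝ) : ℂ) • (Hrn ω * M) := by
      rw [hH, ricianChannel, Matrix.mul_smul, Matrix.add_mul, Matrix.smul_mul, Matrix.smul_mul,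
        smul_add, smul_smul, smul_smul, e1']
    rw [hprod]
    ext i j
    simp only [columnsMatrix, Matrix.of_apply, Matrix.add_apply, Matrix.smul_apply, smul_eq_mul, hd]
    refine Fin.cases ?_ (fun j => ?_) j
    · simp only [hc, Fin.cons_zero, PiLp.add_apply, specularMean, whitenedColumns, hM0, if_true]
      rw [← e2']
      ring
    · simp only [hc, Fin.cons_succ, whitenedColumns, hM0, if_neg (Fin.succ_ne_zero j)]
      ring
  have hMu : IsUnit M.det := by
    have h1 := congrArg Matrix.det hM
    rw [Matrix.det_mul, Matrix.det_one] at h1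
    exact IsUnit.of_mul_eq_one_right _ h1
  have hsM : IsUnit (s • M).det := by
    rw [Matrix.det_smul]
    exact (IsUnit.pow _ (isUnit_iff_ne_zero.mpr hs0)).mul hMu
  have hsMh : IsUnit ((s • M)ᴴ).det := by
    rw [Matrix.det_conjTranspose]; exact hsM.star
  have hinv : (s • M) * ((columnsMatrix c)ᴴ * columnsMatrix c)⁻¹ * (s • M)ᴴ = (Hᴴ * H)⁻¹ := by
    rw [hcol, Matrix.conjTranspose_mul]
    have : (s • M)ᴴ * Hᴴ * (H * (s • M)) = (s • M)ᴴ * ((Hᴴ * H) * (s • M)) := by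
      simp only [Matrix.mul_assoc]
    rw [this, Matrix.mul_inv_rev, Matrix.mul_inv_rev]
    calc _ = ((s • M) * (s • M)⁻¹) * (Hᴴ * H)⁻¹ * (((s • M)ᴴ)⁻¹ * (s • M)ᴴ) := by
          simp only [Matrix.mul_assoc]
      _ = _ := by
          rw [Matrix.mul_nonsing_inv _ hsM, Matrix.nonsing_inv_mul _ hsMh, Matrix.one_mul,
            Matrix.mul_one]
  have h00 : (Hᴴ * H)⁻¹ 0 0 = ((2 * (K + 1) * ρ : ℝ) : ℂ) *
      ((columnsMatrix c)ᴴ * columnsMatrix c)⁻¹ 0 0 := by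
    rw [← hinv, Matrix.mul_apply, Finset.sum_eq_single 0, Matrix.mul_apply,
      Finset.sum_eq_single 0]
    · simp only [Matrix.smul_apply, Matrix.conjTranspose_apply, hM0, if_true, smul_eq_mul,
        Complex.star_def, map_mul, Complex.conj_ofReal]
      have hsc : conj s = s := by rw [hs, Complex.conj_ofReal]
      have hρ2 : ((√ρ : ℝ) : ℂ) * ((√ρ : ℝ) : ℂ) = (ρ : ℂ) := by
        rw [← Complex.ofReal_mul, Real.mul_self_sqrt hρ.le]
      rw [hsc, Complex.ofReal_mul, ← hs2, ← hρ2]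
      ring
    · intro l _ hl
      simp [hM0, hl]
    · simp
    · intro l _ hl
      simp [hM0, hl]
    · simp
  unfold zfSNR scaleΓ₁ residualSq
  rw [← hc, h00, Complex.re_ofReal_mul, ← hρdef]
  -- When this entry vanishes both sides are 0, by the convention for division by 0.
  by_cases hz : (((columnsMatrix c)ᴴ * columnsMatrix c)⁻¹ 0 0).re = 0
  · rw [hz]; simp
  · field_simp

/-- The law of the zero-forcing SNR under Rician–Rayleigh fading. -/
theorem map_zfSNR_ricianChannel {Ω : Type*} [MeasurableSpace Ω] {P : Measure Ω}
    {NR k : ℕ} (hk : k < NR) {K Γs : ℝ} (hK : 0 ≤ K) (hΓs : 0 < Γs)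
    {R : Matrix (Fin (k + 1)) (Fin (k + 1)) ℂ} (hR : R.PosDef)
    {Hdn : Matrix (Fin NR) (Fin (k + 1)) ℂ} (h0 : ∀ i j, j ≠ 0 → Hdn i j = 0)
    {Hrn : Ω → Matrix (Fin NR) (Fin (k + 1)) ℂ} (hH : IsTransmitCorrelatedFading Hrn R P) :
    AEMeasurable (fun ω => zfSNR Γs (ricianChannel K Hdn Hrn ω)) P ∧
    P.map (fun ω => zfSNR Γs (ricianChannel K Hdn Hrn ω)) =
      (volume.restrict (Set.Ici 0)).withDensity (fun t => ENNReal.ofReal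
        (snrDensity (NR - k) NR (‖specularMean K (R⁻¹ 0 0).re Hdn‖ ^ 2 / 2) (scaleΓ₁ Γs K R) t)) := by
  obtain ⟨hρ, M, hM, hM0⟩ := exists_whitening hR
  obtain ⟨hcm, hcl⟩ := hasLaw_whitenedColumns hH hM
  have hΓ : 0 < scaleΓ₁ Γs K R := by unfold scaleΓ₁; positivity
  set m := specularMean K (R⁻¹ 0 0).re Hdn with hm
  set f : EuclideanSpace ℂ (Fin NR) × (Fin k → EuclideanSpace ℂ (Fin NR)) → ℝ :=
    fun p => scaleΓ₁ Γs K R * (residualSq (m + p.1) p.2 / 2) with hf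
  have hfm : Measurable f :=
    ((measurable_residualSq.comp ((measurable_fst.const_add m).prodMk measurable_snd)).div_const
      2).const_mul _
  set e := MeasurableEquiv.piFinSuccAbove (fun _ : Fin (k + 1) => EuclideanSpace ℂ (Fin NR)) 0
    with he
  have hmp := measurePreserving_piFinSuccAbove
    (fun _ : Fin (k + 1) => stdGaussian (EuclideanSpace ℂ (Fin NR))) 0
  have hfun : (fun ω => zfSNR Γs (ricianChannel K Hdn Hrn ω)) =
      f ∘ e ∘ fun ω => whitenedColumns M (Hrn ω) := by
    ext ω
    rw [zfSNR_ricianChannel_eq hK hρ hM hM0 h0]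
    rfl
  have hfe : Measurable (f ∘ e) := hfm.comp e.measurable
  rw [hfun, ← Function.comp_assoc]
  refine ⟨hfe.comp_aemeasurable hcm, ?_⟩
  rw [← AEMeasurable.map_map_of_aemeasurable hfe.aemeasurable hcm, hcl,
    ← Measure.map_map hfm e.measurable, hmp.map_eq]
  exact map_residualSq_stdGaussian m hk hΓ

/-! ### Outage probability and ergodic capacity -/

lemma integrableOn_gammaDensity (k : ℕ) {Γ : ℝ} (hΓ : 0 < Γ) :
    IntegrableOn (gammaDensity (k + 1) Γ) (Set.Ioi 0) := by
  simpa using integrableOn_exp_mul_gammaDensity k (s := 0) hΓ (by simp)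

lemma integral_gammaDensity (k : ℕ) {Γ : ℝ} (hΓ : 0 < Γ) :
    ∫ t in Set.Ioi 0, gammaDensity (k + 1) Γ t = 1 := by
  simpa using integral_exp_mul_gammaDensity k (s := 0) hΓ (by simp)

lemma integral_withDensity_ofReal {p h : ℝ → ℝ} (hp : Measurable p)
    (hp0 : ∀ t, 0 ≤ t → 0 ≤ p t) (hi : IntegrableOn (fun t => h t * p t) (Set.Ioi 0)) :
    Integrable h ((volume.restrict (Set.Ici 0)).withDensity fun t => ENNReal.ofReal (p t)) ∧
    ∫ t, h t ∂((volume.restrict (Set.Ici 0)).withDensity fun t => ENNReal.ofReal (p t)) =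
      ∫ t in Set.Ioi 0, h t * p t := by
  have heq : (fun t => (ENNReal.ofReal (p t)).toReal • h t) =ᵐ[volume.restrict (Set.Ioi 0)]
      fun t => h t * p t := by
    filter_upwards [ae_restrict_mem measurableSet_Ioi] with t ht
    rw [ENNReal.toReal_ofReal (hp0 t (le_of_lt ht)), smul_eq_mul, mul_comm]
  have hfin : ∀ᵐ t ∂(volume.restrict (Set.Ici (0 : ℝ))), ENNReal.ofReal (p t) < ⊤ :=
    Filter.Eventually.of_forall fun t => ENNReal.ofReal_lt_top
  constructor
  · rw [integrable_withDensity_iff_integrable_smul' hp.ennreal_ofReal hfin,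
      Measure.restrict_congr_set Ioi_ae_eq_Ici.symm, integrable_congr heq]
    exact hi
  · rw [integral_withDensity_eq_integral_toReal_smul hp.ennreal_ofReal hfin,
      Measure.restrict_congr_set Ioi_ae_eq_Ici.symm, integral_congr_ae heq]

lemma setIntegral_indicator_Iic_mul (f : ℝ → ℝ) {x : ℝ} (hx : 0 ≤ x) :
    ∫ t in Set.Ioi 0, (Set.Iic x).indicator 1 t * f t = ∫ t in (0 : ℝ)..x, f t := by
  have : ∀ t, (Set.Iic x).indicator (1 : ℝ → ℝ) t * f t = (Set.Iic x).indicator f t := by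
    intro t
    by_cases ht : t ∈ Set.Iic x <;> simp [ht]
  simp_rw [this]
  rw [setIntegral_indicator measurableSet_Iic, Set.Ioi_inter_Iic,
    intervalIntegral.integral_of_le hx]

lemma intervalIntegral_gammaDensity (k : ℕ) {Γ : ℝ} (hΓ : 0 < Γ) (x : ℝ) :
    ∫ t in (0 : ℝ)..x, gammaDensity (k + 1) Γ t =
      lowerIncompleteGamma ((k + 1 : ℕ) : ℝ) (x / Γ) / (k.factorial : ℝ) := by
  have h := intervalIntegral.integral_comp_div (a := 0) (b := x)
    (fun t => t ^ k * Real.exp (-t)) hΓ.ne'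
  have h2 : lowerIncompleteGamma ((k + 1 : ℕ) : ℝ) (x / Γ) =
      ∫ t in (0 : ℝ)..(x / Γ), t ^ k * Real.exp (-t) := by
    unfold lowerIncompleteGamma
    refine intervalIntegral.integral_congr fun t _ => ?_
    simp
  rw [zero_div, smul_eq_mul, ← h2] at h
  have h3 : ∀ t, gammaDensity (k + 1) Γ t =
      1 / (k.factorial * Γ) * ((t / Γ) ^ k * Real.exp (-(t / Γ))) := by
    intro t
    unfold gammaDensity
    rw [Nat.add_sub_cancel, div_pow, neg_div, pow_succ]
    field_simp
  simp_rw [h3]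
  rw [intervalIntegral.integral_const_mul, h]
  field_simp

/-- Shows that the gamma mean is Γ(k + 1). With log(1 + t) ≤ t this supplies the linear growth
needed for termwise integration of the capacity. -/
lemma id_mul_gammaDensity (k : ℕ) {Γ : ℝ} (hΓ : 0 < Γ) (t : ℝ) :
    t * gammaDensity (k + 1) Γ t = Γ * (k + 1) * gammaDensity (k + 1 + 1) Γ t := by
  unfold gammaDensity
  rw [Nat.add_sub_cancel, Nat.add_sub_cancel, Nat.factorial_succ]
  push_cast
  have : (k : ℝ) + 1 ≠ 0 := by positivity
  field_simp
  ring

lemma integral_log_mul_gammaDensity (Q : ℕ) (Γ : ℝ) :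
    ∫ t in Set.Ioi 0, Real.log (1 + t) * gammaDensity (Q + 1) Γ t = capC Q Γ := by
  unfold capC
  rw [← integral_const_mul]
  congr 1
  ext t
  unfold gammaDensity
  rw [Nat.add_sub_cancel, one_div_mul_one_div]
  ring

lemma capB_eq_sum_range {N : ℕ} (hN : 1 ≤ N) (n : ℕ) (Γ : ℝ) :
    capB N n Γ = ∑ m ∈ Finset.range (n + 1), (n.choose m : ℝ) * (-1) ^ m *
      capC (N + n - m - 1) Γ := by
  unfold capB
  -- A gamma density of shape N + n - m has exponent Q = N + n - m - 1, whence the reindexing.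
  refine Finset.sum_nbij' (fun Q => n + N - 1 - Q) (fun m => N + n - m - 1) ?_ ?_ ?_ ?_ ?_
  · intro Q hQ; rw [Finset.mem_Icc] at hQ; rw [Finset.mem_range]; omega
  · intro m hm; rw [Finset.mem_range] at hm; rw [Finset.mem_Icc]; omega
  · intro Q hQ; rw [Finset.mem_Icc] at hQ; omega
  · intro m hm; rw [Finset.mem_range] at hm; omega
  · intro Q hQ
    rw [Finset.mem_Icc] at hQ
    congr 2
    omega

lemma integral_log_mul_snrDensity {N r : ℕ} (hN : 1 ≤ N) (hNr : N ≤ r) {a Γ : ℝ} (ha : 0 ≤ a)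
    (hΓ : 0 < Γ) :
    IntegrableOn (fun t => Real.log (1 + t) * snrDensity N r a Γ t) (Set.Ioi 0) ∧
    HasSum (fun n => coeffA N r n a * capB N n Γ)
      (∫ t in Set.Ioi 0, Real.log (1 + t) * snrDensity N r a Γ t) := by
  have hm : Measurable fun t : ℝ => Real.log (1 + t) := Real.measurable_log.comp (by fun_prop)
  have hdom : ∀ k : ℕ, IntegrableOn (fun t => t * gammaDensity (k + 1) Γ t) (Set.Ioi 0) := by
    intro k
    simp_rw [id_mul_gammaDensity k hΓ]
    exact (integrableOn_gammaDensity (k + 1) hΓ).const_mul _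
  have hle : ∀ k : ℕ, ∀ t ∈ Set.Ioi (0 : ℝ),
      Real.log (1 + t) * gammaDensity (k + 1) Γ t ≤ t * gammaDensity (k + 1) Γ t :=
    fun k t ht => mul_le_mul_of_nonneg_right (log_one_add_mul_le (le_of_lt ht))
      (gammaDensity_nonneg hΓ (le_of_lt ht))
  have hint : ∀ k : ℕ, IntegrableOn (fun t => Real.log (1 + t) * gammaDensity (k + 1) Γ t)
      (Set.Ioi 0) := by
    intro k
    refine Integrable.mono' (hdom k)
      (hm.mul (continuous_gammaDensity (k + 1) Γ).measurable).aestronglyMeasurable ?_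
    filter_upwards [ae_restrict_mem measurableSet_Ioi] with t ht
    rw [Real.norm_of_nonneg (mul_nonneg (log_one_add_nonneg (le_of_lt ht))
      (gammaDensity_nonneg hΓ (le_of_lt ht)))]
    exact hle k t ht
  obtain ⟨h1, h2⟩ := integral_mul_snrDensity hN hNr ha hΓ hm
    (fun t ht => log_one_add_nonneg (le_of_lt ht)) hint (C := Γ) (fun k => by
      refine (setIntegral_mono_on (hint k) (hdom k) measurableSet_Ioi (hle k)).trans ?_
      simp_rw [id_mul_gammaDensity k hΓ]
      rw [integral_const_mul, integral_gammaDensity (k + 1) hΓ, mul_one])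
  refine ⟨h1, ?_⟩
  convert h2 using 2 with n
  rw [capB_eq_sum_range hN]
  congr 1
  refine Finset.sum_congr rfl fun m hm => ?_
  have : N + n - m = N + n - m - 1 + 1 := by rw [Finset.mem_range] at hm; omega
  conv_rhs => rw [this, integral_log_mul_gammaDensity]

lemma integral_snrDensity_eq_hasSum_outageTerm {N r : ℕ} (hN : 1 ≤ N) (hNr : N ≤ r) {a Γ x : ℝ}
    (ha : 0 ≤ a) (hΓ : 0 < Γ) (hx : 0 ≤ x) :
    IntegrableOn (fun t => (Set.Iic x).indicator 1 t * snrDensity N r a Γ t) (Set.Ioi 0) ∧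
    HasSum (outageTerm N r a Γ x) (∫ t in (0 : ℝ)..x, snrDensity N r a Γ t) := by
  have h01 : ∀ t, 0 ≤ (Set.Iic x).indicator (1 : ℝ → ℝ) t ∧
      (Set.Iic x).indicator (1 : ℝ → ℝ) t ≤ 1 := fun t => by
    by_cases ht : t ∈ Set.Iic x <;> simp [ht]
  have hm : Measurable ((Set.Iic x).indicator (1 : ℝ → ℝ)) :=
    measurable_one.indicator measurableSet_Iic
  have hle : ∀ k : ℕ, ∀ t ∈ Set.Ioi (0 : ℝ),
      (Set.Iic x).indicator 1 t * gammaDensity (k + 1) Γ t ≤ gammaDensity (k + 1) Γ t :=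
    fun k t ht => mul_le_of_le_one_left (gammaDensity_nonneg hΓ (le_of_lt ht)) (h01 t).2
  have hint : ∀ k : ℕ, IntegrableOn
      (fun t => (Set.Iic x).indicator 1 t * gammaDensity (k + 1) Γ t) (Set.Ioi 0) := by
    intro k
    refine Integrable.mono' (integrableOn_gammaDensity k hΓ)
      (hm.mul (continuous_gammaDensity (k + 1) Γ).measurable).aestronglyMeasurable ?_
    filter_upwards [ae_restrict_mem measurableSet_Ioi] with t ht
    rw [Real.norm_of_nonneg (mul_nonneg (h01 t).1 (gammaDensity_nonneg hΓ (le_of_lt ht)))]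
    exact hle k t ht
  obtain ⟨h1, h2⟩ := integral_mul_snrDensity hN hNr ha hΓ hm (fun t _ => (h01 t).1) hint (C := 1)
    (fun k => by
      refine (setIntegral_mono_on (hint k) (integrableOn_gammaDensity k hΓ) measurableSet_Ioi
        (hle k)).trans ?_
      rw [integral_gammaDensity k hΓ]
      have : (0 : ℝ) ≤ k := Nat.cast_nonneg k
      linarith)
  refine ⟨h1, ?_⟩
  rw [setIntegral_indicator_Iic_mul _ hx] at h2
  convert h2 using 2 with n
  unfold outageTerm
  congr 1
  refine Finset.sum_congr rfl fun m hm => ?_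
  have : N + n - m = N + n - m - 1 + 1 := by rw [Finset.mem_range] at hm; omega
  rw [setIntegral_indicator_Iic_mul _ hx]
  conv_rhs => rw [this, intervalIntegral_gammaDensity _ hΓ, ← this]

theorem mainTheorem7 {Ω : Type*} [MeasurableSpace Ω] (P : Measure Ω) [IsProbabilityMeasure P]
    (NR NT N : ℕ) [NeZero NT] (hNT : NT ≤ NR) (hN : N = NR - NT + 1)
    (K Γs : ℝ) (hK : 0 ≤ K) (hΓs : 0 < Γs)
    (RT : Matrix (Fin NT) (Fin NT) ℂ) (hRT : RT.PosDef) (hRTdiag : ∀ i, RT i i = 1)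
    (Hdn : Matrix (Fin NR) (Fin NT) ℂ)
    (hHdn_norm : ∑ i, ∑ j, ‖Hdn i j‖ ^ 2 = (NT : ℝ) * NR)
    (hHdn_rayleigh : ∀ i j, j ≠ 0 → Hdn i j = 0)
    (Hrn : Ω → Matrix (Fin NR) (Fin NT) ℂ) (hHrn : IsTransmitCorrelatedFading Hrn RT P)
    (γ₁ : Ω → ℝ) (hγ₁ : ∀ ω, γ₁ ω = zfSNR Γs (ricianChannel K Hdn Hrn ω))
    (Γ₁ a : ℝ) (hΓ₁ : Γ₁ = scaleΓ₁ Γs K RT) (ha : a = ricianParam NR K RT) :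
    -- the SNR has the density `p_{γ₁}` on `[0, ∞)`, given by a convergent series
    (AEMeasurable γ₁ P ∧ (∀ t, 0 ≤ t → Summable (densityTerm N NR a Γ₁ t)) ∧
      (∀ t, 0 ≤ t → 0 ≤ snrDensity N NR a Γ₁ t) ∧
      P.map γ₁ = (volume.restrict (Set.Ici 0)).withDensity
        (fun t => ENNReal.ofReal (snrDensity N NR a Γ₁ t))) ∧
    -- outage probability
    (∀ γth : ℝ, 0 ≤ γth →
      P.real {ω | γ₁ ω ≤ γth} = ∫ t in (0 : ℝ)..γth, snrDensity N NR a Γ₁ t ∧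
      HasSum (outageTerm N NR a Γ₁ γth) (P.real {ω | γ₁ ω ≤ γth})) ∧
    -- ergodic capacity
    (Integrable (fun ω => Real.logb 2 (1 + γ₁ ω)) P ∧
      ∫ ω, Real.logb 2 (1 + γ₁ ω) ∂P =
        ∫ t in Set.Ioi (0 : ℝ), 1 / Real.log 2 * Real.log (1 + t) * snrDensity N NR a Γ₁ t ∧
      Summable (fun n => coeffA N NR n a * capB N n Γ₁) ∧
      ∫ ω, Real.logb 2 (1 + γ₁ ω) ∂P =
        1 / Real.log 2 * ∑' n, coeffA N NR n a * capB N n Γ₁) ∧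
    -- evaluation of `C_Q(Γ₁)`
    (∀ Q : ℕ,
      IntegrableOn (fun t => Real.log (1 + t) * t ^ Q * Real.exp (-t / Γ₁)) (Set.Ioi 0) ∧
      capC Q Γ₁ = 1 / (Q.factorial : ℝ) *
        ∫ y in Set.Ioi (0 : ℝ), Real.log (1 + Γ₁ * y) * y ^ Q * Real.exp (-y) ∧
      capC Q Γ₁ = Real.exp (1 / Γ₁) * expIntegralE₁ (1 / Γ₁) +
        ∑ q₁ ∈ Finset.Icc 1 Q, 1 / (q₁.factorial : ℝ) *
          ((-1 / Γ₁) ^ q₁ * (Real.exp (1 / Γ₁) * expIntegralE₁ (1 / Γ₁)) +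
            ∑ q₂ ∈ Finset.range q₁, (-1 / Γ₁) ^ q₂ * ((q₁ - q₂ - 1).factorial : ℝ))) := by

  -- Here k counts the interfering columns, so N = NR - k is the complex dimension of the complement
  -- of their span when they are independent.
  obtain ⟨k, rfl⟩ : ∃ k, NT = k + 1 := ⟨NT - 1, by have := NeZero.ne NT; omega⟩
  have hk : k < NR := hNT
  obtain rfl : N = NR - k := by omega
  have hN1 : 1 ≤ NR - k := by omega
  have hNr : NR - k ≤ NR := Nat.sub_le _ _
  have hρ : 0 < (RT⁻¹ 0 0).re := (exists_whitening hRT).1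
  have hΓ : 0 < Γ₁ := by rw [hΓ₁]; unfold scaleΓ₁; positivity
  have hm : ‖specularMean K (RT⁻¹ 0 0).re Hdn‖ ^ 2 / 2 = a := by
    rw [norm_sq_specularMean hK hρ.le hHdn_rayleigh, hHdn_norm, ha, ricianParam]
    ring
  have ha0 : 0 ≤ a := by rw [← hm]; positivity
  obtain ⟨hmeas, hlaw⟩ := map_zfSNR_ricianChannel hk hK hΓs hRT hHdn_rayleigh hHrn
  obtain rfl : γ₁ = fun ω => zfSNR Γs (ricianChannel K Hdn Hrn ω) := funext hγ₁
  have hp0 : ∀ t, 0 ≤ t → 0 ≤ snrDensity (NR - k) NR a Γ₁ t := fun t ht => by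
    rw [← hm]; exact snrDensity_nonneg _ hk hΓ ht
  rw [hm, ← hΓ₁] at hlaw
  have hpm := measurable_snrDensity (NR - k) NR a Γ₁
  refine ⟨⟨hmeas, fun t ht => summable_densityTerm hN1 hNr ha0 hΓ ht, hp0, hlaw⟩, ?_, ?_, ?_⟩
  · intro x hx
    obtain ⟨hi, hs⟩ := integral_snrDensity_eq_hasSum_outageTerm hN1 hNr ha0 hΓ hx
    have h1 : P.real {ω | zfSNR Γs (ricianChannel K Hdn Hrn ω) ≤ x} =
        ∫ t in (0 : ℝ)..x, snrDensity (NR - k) NR a Γ₁ t := by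
      -- The outage probability is the expectation of the indicator of (-∞, x] under the law of the
      -- SNR.
      have h2 := (integral_withDensity_ofReal hpm hp0 hi).2
      rw [← hlaw, setIntegral_indicator_Iic_mul _ hx, integral_indicator_one measurableSet_Iic,
        map_measureReal_apply_of_aemeasurable hmeas measurableSet_Iic] at h2
      exact h2
    exact ⟨h1, h1 ▸ hs⟩
  · obtain ⟨hi, hs⟩ := integral_log_mul_snrDensity hN1 hNr ha0 hΓ
    obtain ⟨h1, h2⟩ := integral_withDensity_ofReal hpm hp0 hi
    have hlm : Measurable fun t : ℝ => Real.log (1 + t) := Real.measurable_log.comp (by fun_prop)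
    rw [← hlaw] at h1 h2
    rw [integral_map hmeas hlm.aestronglyMeasurable] at h2
    have h3 := h1.comp_aemeasurable hmeas
    have h4 : ∫ ω, Real.logb 2 (1 + zfSNR Γs (ricianChannel K Hdn Hrn ω)) ∂P =
        1 / Real.log 2 * ∫ t in Set.Ioi 0, Real.log (1 + t) * snrDensity (NR - k) NR a Γ₁ t := by
      rw [← h2, ← integral_const_mul]
      refine integral_congr_ae (Filter.Eventually.of_forall fun ω => ?_)
      simp only [Real.logb]
      ring
    refine ⟨h3.div_const _, ?_, hs.summable, ?_⟩
    · rw [h4, ← integral_const_mul]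
      simp_rw [mul_assoc]
    · rw [h4, hs.tsum_eq]
  · intro Q
    refine ⟨?_, capC_eq_integral_log_one_add_mul Q hΓ, capC_eq Q hΓ⟩
    have h := integrableOn_log_mul_pow_mul_exp Q one_pos (by positivity : 0 < 1 / Γ₁)
    refine h.congr (Filter.Eventually.of_forall fun t => ?_)
    simp only [one_mul]
    rw [neg_div, one_div, inv_mul_eq_div]
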